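/- **The game.** Let $G$ be a finite graph and $r,m,s$ non-negative integers with $m\ge 1$. In the game of Revolutionaries and Spies on $G$, first $r$ revolutionaries are placed on vertices of $G$, then $s$ spies are placed on vertices of $G$ (a vertex may hold several players); this is round $0$. In each later round, first each revolutionary stays where he is or moves to an adjacent vertex, and then each spy does the same; both teams have perfect information. There is an unguarded meeting if some vertex holds at least $m$ revolutionaries and no spy. The spies win if they have a strategy ensuring that there is no unguarded meeting at the end of any round (including round $0$). The spy number $\sigma(G,r,m)$ is the minimum $s$ for which $s$ spies win. **Theorem 1.6.** Let $\eta\in(0,\tfrac12)$, let $p=p(n)\in[0,1]$ satisfy $np=n^{\eta+o(1)}$, let $r=r(n)$ and $m=m(n)\ge 1$ be integers with $r-m\to\infty$, and let $\omega=\omega(n)$ be any real function with $\omega\to\infty$ and $\omega=n^{o(1)}$, i.e. $\omega=o(n^{\delta})$ for every $\delta>0$. All asymptotics are as $n\to\infty$, and inequalities between functions of $n$ are required for all sufficiently large $n$. Suppose that one of the following holds: - (i) $r-m=o\big(\min\{pn,\ n/(pn)^2\}\big)$ and $pn\ge(\omega n\log n)^{1/4}$; - (ii) $r-m=o\big(pn/(\omega\log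 n)\big)$ and $(\omega n\log n)^{1/6}\le pn<(\omega n\log n)^{1/4}$; - (iii) $r-m=o(pn)$ and $pn<(\omega n\log n)^{1/6}$. Then for the binomial random graph $G\in G(n,p)$, asymptotically almost surely $\sigma(G,r,m)=(1+o(1))(r-m)$; that is, for every $\varepsilon>0$, $$\mathbb P\big(|\sigma(G,r,m)-(r-m)|\le\varepsilon\,(r-m)\big)\longrightarrow 1\qquad(n\to\infty).$$ -/

import Mathlib

open Filter Topology Asymptotics

/-! ### The game of Revolutionaries and Spies -/

namespace RevSpies

variable {V : Type*}

/-- One team, with one player for each element of `ι`, may pass from the positions `P` to the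
positions `Q` in one turn: each player stays where he is or moves to an adjacent vertex. -/
def Move (G : SimpleGraph V) {ι : Type*} (P Q : ι → V) : Prop :=
  ∀ i, Q i = P i ∨ G.Adj (P i) (Q i)

/-- There is an unguarded meeting: some vertex holds at least `m` revolutionaries and no spy. -/
def UnguardedMeeting (m : ℕ) {r s : ℕ} (R : Fin r → V) (S : Fin s → V) : Prop :=
  ∃ v : V, m ≤ {i | R i = v}.ncard ∧ ∀ k, S k ≠ v

/-- A strategy of the team of `s` spies against `r` revolutionaries. In round `t` the
revolutionaries play first, so the positions of the spies at the end of round `t` may depend on the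
positions of the revolutionaries in rounds `0, …, t` (round `0` is the initial placement). -/
def SpyStrategy (V : Type*) (r s : ℕ) : Type _ :=
  (t : ℕ) → (Fin (t + 1) → Fin r → V) → Fin s → V

/-- The positions of the spies at the end of round `t`, when they follow the strategy `f` and the
revolutionaries occupy the positions `R 0, R 1, …`. -/
def SpyStrategy.play {r s : ℕ} (f : SpyStrategy V r s) (R : ℕ → Fin r → V) (t : ℕ) : Fin s → V :=
  f t fun i => R i

/-- `s` spies win on `G` against `r` revolutionaries and meeting size `m`: they have a strategy
which, against every legal play of the revolutionaries, makes only legal moves and leaves no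
unguarded meeting at the end of any round. -/
def SpiesWin (G : SimpleGraph V) (r m s : ℕ) : Prop :=
  ∃ f : SpyStrategy V r s, ∀ R : ℕ → Fin r → V, (∀ t, Move G (R t) (R (t + 1))) →
    (∀ t, Move G (f.play R t) (f.play R (t + 1))) ∧
    ∀ t, ¬ UnguardedMeeting m (R t) (f.play R t)

/-- The spy number `σ(G, r, m)`: the minimum number of spies that win on `G`. -/
noncomputable def spyNumber (G : SimpleGraph V) (r m : ℕ) : ℕ :=
  sInf {s | SpiesWin G r m s}

end RevSpies

/-- For random graphs `G ∈ G(n, p n)` on the vertex set `Fin n`, the property `A n` holds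
asymptotically almost surely. -/
def AAS (p : ℕ → unitInterval) (A : (n : ℕ) → SimpleGraph (Fin n) → Prop) : Prop :=
  Tendsto (fun n => SimpleGraph.binomialRandom (Fin n) (p n) {G | A n G}) atTop (𝓝 1)

/-! Write `k = r - m` and `d = np`. For the upper bound, `k + 1` spies shadow distinct
revolutionaries, which leaves only `m - 1` unshadowed (`spiesWin_of_lt`).

For the lower bound, let `q` be about `εk` and suppose that there are at most `k - q` spies. The
strategy of the revolutionaries (`not_spiesWin`) is deterministic and rests on two expansion
properties. First, the closed neighbourhood of a vertex without spies contains many vertices that no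
spy can reach in one move. Hence the revolutionaries can scatter by repeated halving until each spy
accompanies at most one of them, and the other `m + q` or more can stay unspied forever. Second,
among any `q` distinct vertices `B` one can meet a given vertex `a` within `t` rounds at a place
that no spy reaches in time. So a group of unspied revolutionaries gains one member at a time, until
it has `m`.

In the random graph, balls of radius `j ≤ t = i + 1` have order `d ^ j` vertices and overlap little
(`Regular`, `exists_le_card_cball`). Thus `a` keeps order `d ^ (i + 1)` candidate vertices out of
reach of the spies, `B` keeps order `q * d ^ i` vertices, and the pairs between the two sets are
unrevealed (`exists_regular_bounds`). If no meeting is possible, none of these pairs is an edge,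
which has probability at most `exp (-c * q * d ^ (2 * i + 2) / n)`. This beats the `exp (O(k log
n))` choices of `a`, `S`, `B` (`aas_evade_and_meet`). As the pairs depend on the graph, independence
is replaced by an adaptive moment identity (`sum_adaptive`).

What is needed is `k = o(d)`, `k * d ^ (i + 1) = o(n)` and `n log n = o(d ^ (2 * i + 2))`. The three
regimes satisfy this with `i = 1`, `i = 2` and `i = ⌊1 / (2η)⌋`. -/

namespace RevSpies

/-! ### Balls in a graph. -/

section Ball

variable {V : Type*} [Fintype V] [DecidableEq V]

open Classical in
/-- The vertices at distance at most `j` from the set `X`. -/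
noncomputable def cball (G : SimpleGraph V) : ℕ → Finset V → Finset V
  | 0, X => X
  | j + 1, X => Finset.univ.filter fun v => ∃ u ∈ cball G j X, v = u ∨ G.Adj u v

variable {G : SimpleGraph V} {j : ℕ} {X Y : Finset V} {u v w : V}

@[simp] lemma cball_zero : cball G 0 X = X := rfl

lemma mem_cball_succ : v ∈ cball G (j + 1) X ↔ ∃ u ∈ cball G j X, v = u ∨ G.Adj u v := by
  simp [cball]

lemma mem_cball_one : v ∈ cball G 1 {u} ↔ v = u ∨ G.Adj u v := by
  simp [mem_cball_succ]

lemma mem_cball_one_self : u ∈ cball G 1 {u} := mem_cball_one.2 (Or.inl rfl)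

lemma cball_subset_succ : cball G j X ⊆ cball G (j + 1) X := fun v hv =>
  mem_cball_succ.2 ⟨v, hv, Or.inl rfl⟩

lemma cball_subset_of_le {i : ℕ} (h : i ≤ j) : cball G i X ⊆ cball G j X := by
  induction h with
  | refl => exact subset_rfl
  | step _ ih => exact ih.trans cball_subset_succ

lemma cball_mono (h : X ⊆ Y) : cball G j X ⊆ cball G j Y := by
  induction j with
  | zero => exact h
  | succ j ih =>
    intro v hv
    obtain ⟨u, hu, huv⟩ := mem_cball_succ.1 hv
    exact mem_cball_succ.2 ⟨u, ih hu, huv⟩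

lemma mem_cball_iff_exists : v ∈ cball G j X ↔ ∃ x ∈ X, v ∈ cball G j {x} := by
  induction j generalizing v with
  | zero => simp
  | succ j ih =>
    simp only [mem_cball_succ]
    constructor
    · rintro ⟨u, hu, huv⟩
      obtain ⟨x, hx, hux⟩ := ih.1 hu
      exact ⟨x, hx, u, hux, huv⟩
    · rintro ⟨x, hx, u, hu, huv⟩
      exact ⟨u, ih.2 ⟨x, hx, hu⟩, huv⟩

lemma cball_eq_biUnion : cball G j X = X.biUnion fun x => cball G j {x} := by
  ext v
  rw [mem_cball_iff_exists]
  simp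

lemma cball_succ_eq : cball G (j + 1) X = cball G j (cball G 1 X) := by
  induction j with
  | zero => simp
  | succ j ih =>
    ext v
    rw [mem_cball_succ, ih, mem_cball_succ]

lemma mem_cball_comm : v ∈ cball G j {u} ↔ u ∈ cball G j {v} := by
  induction j generalizing u v with
  | zero => simp [eq_comm]
  | succ j ih =>
    rw [mem_cball_succ, cball_succ_eq, mem_cball_iff_exists]
    constructor
    · rintro ⟨x, hx, h⟩
      exact ⟨x, mem_cball_one.2 (h.imp Eq.symm fun h => h.symm), ih.1 hx⟩
    · rintro ⟨x, hx, h⟩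
      exact ⟨x, ih.2 h, (mem_cball_one.1 hx).imp Eq.symm fun h => h.symm⟩

end Ball

/-! ### Positional form of a spy strategy, and the upper bound. -/

section Game

variable {V : Type*} {G : SimpleGraph V} {r m s : ℕ}

/-- A winning strategy of the spies gives a set of safe positions from which the spies can answer
every move and remain safe. -/
lemma SpiesWin.exists_safe (h : SpiesWin G r m s) :
    ∃ Safe : (Fin r → V) → (Fin s → V) → Prop, (∀ R, ∃ S, Safe R S) ∧
      (∀ R S, Safe R S → ¬ UnguardedMeeting m R S) ∧
      ∀ R S R', Safe R S → Move G R R' → ∃ S', Move G S S' ∧ Safe R' S' := by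
  obtain ⟨f, hf⟩ := h
  -- Safe positions are those that arise in some legal play against `f`.
  refine ⟨fun R S => ∃ (P : ℕ → Fin r → V) (t : ℕ), (∀ t, Move G (P t) (P (t + 1))) ∧
    P t = R ∧ f.play P t = S, fun R => ⟨_, fun _ => R, 0, fun _ _ => Or.inl rfl, rfl, rfl⟩, ?_, ?_⟩
  · rintro R S ⟨P, t, hP, rfl, rfl⟩
    exact (hf P hP).2 t
  · rintro R S R' ⟨P, t, hP, rfl, rfl⟩ hR'
    -- The play is cut at time `t` and frozen at `R'`. Since `f` sees only the past, its earlier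
    -- answers are unchanged.
    let P' : ℕ → Fin r → V := fun i => if i ≤ t then P i else R'
    have hP' : ∀ i, Move G (P' i) (P' (i + 1)) := by
      intro i
      by_cases h1 : i + 1 ≤ t
      · simp only [P', h1, (Nat.le_succ i).trans h1, if_true]
        exact hP i
      · by_cases h2 : i ≤ t
        · obtain rfl : i = t := by omega
          simpa [P'] using hR'
        · simp only [P', h1, h2, if_false]
          exact fun _ => Or.inl rfl
    have hplay : f.play P' t = f.play P t := by
      unfold SpyStrategy.play
      congr 1
      funext i
      simp [P', Nat.le_of_lt_succ i.2]
    refine ⟨f.play P' (t + 1), hplay ▸ (hf P' hP').1 t, P', t + 1, hP', ?_, rfl⟩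
    simp [P']

/-- Each of `r - m + 1` spies follows a revolutionary. -/
lemma spiesWin_of_lt (hs : s ≤ r) (h : r < m + s) : SpiesWin G r m s := by
  refine ⟨fun t R k => R (Fin.last t) (Fin.castLE hs k), fun R hR =>
    ⟨fun t k => by simpa [SpyStrategy.play] using hR t (Fin.castLE hs k), ?_⟩⟩
  rintro t ⟨v, hv, hS⟩
  have hsub : {i | R t i = v} ⊆ (Set.range (Fin.castLE hs))ᶜ := by
    rintro i hi ⟨k, rfl⟩
    exact hS k (by simpa [SpyStrategy.play] using hi)
  have h1 := Set.ncard_le_ncard hsub (Set.toFinite _)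
  rw [Set.ncard_compl, Set.ncard_range_of_injective (Fin.castLE_injective hs)] at h1
  simp at h1
  omega

/-- The spy number lies between the bounds that the two strategies give. -/
lemma spyNumber_bounds {k s₀ : ℕ} (hm : 1 ≤ m) (hr : r = m + k)
    (hlow : ∀ s ≤ s₀, ¬ SpiesWin G r m s) :
    s₀ < spyNumber G r m ∧ spyNumber G r m ≤ k + 1 := by
  have hmem : k + 1 ∈ {s | SpiesWin G r m s} := spiesWin_of_lt (by omega) (by omega)
  refine ⟨?_, Nat.sInf_le hmem⟩
  by_contra h
  exact hlow _ (not_lt.1 h) (Nat.sInf_mem ⟨_, hmem⟩)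

end Game

/-! ### The strategy of the revolutionaries. -/

section Strategy

variable {V : Type*} [Fintype V] [DecidableEq V] {G : SimpleGraph V} {r m s q t : ℕ}

variable {Safe : (Fin r → V) → (Fin s → V) → Prop}

lemma move_mem_cball {ι : Type*} {P Q : ι → V} (h : Move G P Q) (i : ι) :
    Q i ∈ cball G 1 {P i} := mem_cball_one.2 (h i)

/-- The revolutionaries at each `x` split evenly between two vertices that no spy from elsewhere can
reach. A spy can therefore only accompany revolutionaries who shared his vertex before, and only one
half of them. -/
lemma card_filter_spy_halve
    (hstep : ∀ R S R', Safe R S → Move G R R' → ∃ S', Move G S S' ∧ Safe R' S')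
    (hA : ∀ (x : V) (S : Finset V), x ∉ S → S.card ≤ s →
      2 ≤ (cball G 1 {x} \ cball G 1 S).card)
    {f : ℕ} {R : Fin r → V} {S : Fin s → V} (hRS : Safe R S)
    (hf : ∀ k, (Finset.univ.filter fun i => R i = S k).card ≤ 2 ^ (f + 1)) :
    ∃ R' S', Safe R' S' ∧ ∀ k, (Finset.univ.filter fun i => R' i = S' k).card ≤ 2 ^ f := by
  classical
  -- Spies standing on `x` itself are left out, since `hA` requires `x ∉ S`.
  have hy : ∀ x, ∃ y₁ ∈ cball G 1 {x} \ cball G 1 ((Finset.univ.image S).erase x),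
      ∃ y₂ ∈ cball G 1 {x} \ cball G 1 ((Finset.univ.image S).erase x), y₁ ≠ y₂ := by
    intro x
    refine Finset.one_lt_card.1 (hA x _ (Finset.notMem_erase _ _) ?_)
    exact (Finset.card_erase_le.trans Finset.card_image_le).trans (by simp)
  choose y₁ hy₁ y₂ hy₂ hne using hy
  have hH : ∀ x, ∃ H ⊆ Finset.univ.filter (fun i => R i = x),
      H.card = (Finset.univ.filter fun i => R i = x).card / 2 := fun x =>
    Finset.exists_subset_card_eq (Nat.div_le_self _ _)
  choose H hHsub hHcard using hH
  let R' : Fin r → V := fun i => if i ∈ H (R i) then y₁ (R i) else y₂ (R i)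
  have hR'mem : ∀ i, R' i ∈ cball G 1 {R i} \ cball G 1 ((Finset.univ.image S).erase (R i)) := by
    intro i
    by_cases h : i ∈ H (R i)
    · simpa only [R', h, if_true] using hy₁ (R i)
    · simpa only [R', h, if_false] using hy₂ (R i)
  obtain ⟨S', hS', hsafe⟩ := hstep R S R' hRS fun i =>
    mem_cball_one.1 (Finset.mem_sdiff.1 (hR'mem i)).1
  refine ⟨R', S', hsafe, fun k => ?_⟩
  have hfrom : ∀ i, R' i = S' k → R i = S k := by
    intro i hi
    by_contra hne'
    refine (Finset.mem_sdiff.1 (hR'mem i)).2 (mem_cball_iff_exists.2 ⟨S k, ?_, ?_⟩)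
    · exact Finset.mem_erase.2 ⟨fun h => hne' h.symm, Finset.mem_image_of_mem _ (Finset.mem_univ _)⟩
    · rw [hi]; exact move_mem_cball hS' k
  have hc := hf k
  have hHc := hHcard (S k)
  by_cases h : S' k = y₁ (S k)
  · have : (Finset.univ.filter fun i => R' i = S' k) ⊆ H (S k) := by
      intro i hi
      have hi' := (Finset.mem_filter.1 hi).2
      have hRi := hfrom i hi'
      by_contra hn
      rw [← hRi] at hn h
      simp only [R', hn, if_false] at hi'
      exact hne _ (h.symm.trans hi'.symm)
    have := Finset.card_le_card this
    rw [pow_succ] at hc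
    omega
  · have : (Finset.univ.filter fun i => R' i = S' k) ⊆
        (Finset.univ.filter fun i => R i = S k) \ H (S k) := by
      intro i hi
      have hi' := (Finset.mem_filter.1 hi).2
      have hRi := hfrom i hi'
      refine Finset.mem_sdiff.2 ⟨Finset.mem_filter.2 ⟨Finset.mem_univ _, hRi⟩, fun hn => h ?_⟩
      rw [← hRi] at hn ⊢
      simpa only [R', hn, if_true] using hi'.symm
    have := Finset.card_le_card this
    rw [Finset.card_sdiff_of_subset (hHsub _)] at this
    rw [pow_succ] at hc
    omega

/-- The revolutionaries scatter until at most one of them is followed by each spy. -/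
lemma exists_safe_unspied (hinit : ∀ R, ∃ S, Safe R S)
    (hstep : ∀ R S R', Safe R S → Move G R R' → ∃ S', Move G S S' ∧ Safe R' S')
    (hA : ∀ (x : V) (S : Finset V), x ∉ S → S.card ≤ s →
      2 ≤ (cball G 1 {x} \ cball G 1 S).card) [Nonempty V] :
    ∃ R S, Safe R S ∧ ∃ U : Finset (Fin r), r ≤ U.card + s ∧ ∀ i ∈ U, ∀ k, S k ≠ R i := by
  classical
  have hind : ∀ f : ℕ, (∃ R S, Safe R S ∧
      ∀ k, (Finset.univ.filter fun i => R i = S k).card ≤ 2 ^ f) →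
      ∃ R S, Safe R S ∧ ∀ k, (Finset.univ.filter fun i => R i = S k).card ≤ 1 := by
    intro f
    induction f with
    | zero => exact fun h => by simpa using h
    | succ f ih =>
      rintro ⟨R, S, hRS, hf⟩
      exact ih (card_filter_spy_halve hstep hA hRS hf)
  obtain ⟨S, hS⟩ := hinit fun _ => Classical.arbitrary V
  -- As `r ≤ 2 ^ r`, `r` halvings suffice from any start.
  obtain ⟨R, S, hRS, h1⟩ := hind r ⟨_, S, hS, fun k =>
    (Finset.card_le_univ _).trans (by simpa using Nat.lt_two_pow_self.le)⟩
  refine ⟨R, S, hRS, Finset.univ.filter fun i => ∀ k, S k ≠ R i, ?_,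
    fun i hi => (Finset.mem_filter.1 hi).2⟩
  have hcompl : (Finset.univ.filter fun i => ¬ ∀ k, S k ≠ R i) ⊆
      Finset.univ.biUnion fun k => Finset.univ.filter fun i => R i = S k := by
    intro i hi
    have := (Finset.mem_filter.1 hi).2
    push Not at this
    obtain ⟨k, hk⟩ := this
    simp only [Finset.mem_biUnion, Finset.mem_univ, Finset.mem_filter, true_and]
    exact ⟨k, hk.symm⟩
  have h2 := (Finset.card_le_card hcompl).trans (Finset.card_biUnion_le.trans
    (Finset.sum_le_sum fun k _ => h1 k))
  have h3 := Finset.card_filter_add_card_filter_not (s := (Finset.univ : Finset (Fin r)))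
    (fun i => ∀ k, S k ≠ R i)
  simp only [Finset.card_univ, Fintype.card_fin, Finset.sum_const, smul_eq_mul, mul_one] at h2 h3
  omega

/-- Revolutionaries who are closer to `w` than every spy can meet at `w`, while the others evade
the spies. -/
lemma exists_safe_gathered
    (hstep : ∀ R S R', Safe R S → Move G R R' → ∃ S', Move G S S' ∧ Safe R' S')
    (hA : ∀ (x : V) (S : Finset V), x ∉ S → S.card ≤ s →
      (cball G 1 {x} \ cball G 1 S).Nonempty)
    (U A : Finset (Fin r)) (w : V) :
    ∀ (j : ℕ) (R : Fin r → V) (S : Fin s → V), Safe R S → (∀ i ∈ U, ∀ k, S k ≠ R i) →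
      (∀ i ∈ A, R i ∈ cball G j {w}) → (∀ k, S k ∉ cball G j {w}) →
      ∃ R' S', Safe R' S' ∧ (∀ i ∈ U, ∀ k, S' k ≠ R' i) ∧ ∀ i ∈ A, R' i = w := by
  classical
  intro j
  induction j with
  | zero =>
    intro R S hRS hU hAw _
    exact ⟨R, S, hRS, hU, fun i hi => by simpa using hAw i hi⟩
  | succ j ih =>
    intro R S hRS hU hAw hSw
    -- Members of `A` step towards `w`, the rest of `U` evades all spies, and everyone else stays.
    have hmove : ∀ i, ∃ y, y ∈ cball G 1 {R i} ∧ (i ∈ A → y ∈ cball G j {w}) ∧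
        (i ∈ U → i ∉ A → y ∉ cball G 1 (Finset.univ.image S)) := by
      intro i
      by_cases hiA : i ∈ A
      · obtain ⟨y, hy, hyR⟩ := mem_cball_succ.1 (hAw i hiA)
        exact ⟨y, mem_cball_comm.1 (mem_cball_one.2 hyR), fun _ => hy, fun _ h => absurd hiA h⟩
      · by_cases hiU : i ∈ U
        · obtain ⟨y, hy⟩ := hA (R i) (Finset.univ.image S)
            (by simpa using hU i hiU) (Finset.card_image_le.trans (by simp))
          rw [Finset.mem_sdiff] at hy
          exact ⟨y, hy.1, fun h => absurd h hiA, fun _ _ => hy.2⟩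
        · exact ⟨R i, mem_cball_one_self, fun h => absurd h hiA, fun h => absurd h hiU⟩
    choose R' hR' hR'A hR'U using hmove
    obtain ⟨S', hS', hsafe⟩ := hstep R S R' hRS fun i => mem_cball_one.1 (hR' i)
    -- A spy outside radius `j + 1` cannot enter radius `j` in one move. This also keeps `A` unspied
    -- on its way.
    have hS'w : ∀ k, S' k ∉ cball G j {w} := fun k hk =>
      hSw k (mem_cball_succ.2 ⟨S' k, hk, mem_cball_one.1 (mem_cball_comm.1 (move_mem_cball hS' k))⟩)
    refine ih R' S' hsafe ?_ hR'A hS'w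
    intro i hi k hk
    by_cases hiA : i ∈ A
    · exact hS'w k (hk ▸ hR'A i hiA)
    · refine hR'U i hi hiA (hk ▸ mem_cball_iff_exists.2 ⟨S k, ?_, move_mem_cball hS' k⟩)
      exact Finset.mem_image_of_mem _ (Finset.mem_univ _)

/-- One more revolutionary joins the group `A`. -/
lemma exists_safe_insert
    (hstep : ∀ R S R', Safe R S → Move G R R' → ∃ S', Move G S S' ∧ Safe R' S')
    (hq : 1 ≤ q)
    (hA : ∀ (x : V) (S : Finset V), x ∉ S → S.card ≤ s →
      q ≤ (cball G 1 {x} \ cball G 1 S).card)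
    (hB : ∀ (a : V) (S B : Finset V), a ∉ S → a ∉ B → Disjoint S B → S.card ≤ s → B.card = q →
      ∃ b ∈ B, ∃ w, w ∈ cball G t {a} ∧ w ∈ cball G t {b} ∧ w ∉ cball G t S)
    (U A : Finset (Fin r)) (hAU : A ⊆ U) (hcard : A.card + q ≤ U.card) (hAne : A.Nonempty)
    {R : Fin r → V} {S : Fin s → V} (hRS : Safe R S) (hU : ∀ i ∈ U, ∀ k, S k ≠ R i)
    {a : V} (ha : ∀ i ∈ A, R i = a) :
    ∃ R' S', Safe R' S' ∧ (∀ i ∈ U, ∀ k, S' k ≠ R' i) ∧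
      ∃ A' ⊆ U, A'.card = A.card + 1 ∧ ∃ a', ∀ i ∈ A', R' i = a' := by
  classical
  obtain ⟨Q, hQ, hQcard⟩ : ∃ Q ⊆ U \ A, Q.card = q :=
    Finset.exists_subset_card_eq (by rw [Finset.card_sdiff_of_subset hAU]; omega)
  have hQA : ∀ i ∈ Q, i ∉ A := fun i hi => (Finset.mem_sdiff.1 (hQ hi)).2
  have hQU : ∀ i ∈ Q, i ∈ U := fun i hi => (Finset.mem_sdiff.1 (hQ hi)).1
  set T := Finset.univ.image S with hT
  have hTcard : T.card ≤ s := Finset.card_image_le.trans (by simp)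
  have hTU : ∀ i ∈ U, R i ∉ T := fun i hi => by simpa [hT] using hU i hi
  -- The revolutionaries in `Q` escape to distinct vertices, so that they form a set `B` of exactly
  -- `q` vertices. Hall's condition is immediate: there are `q` sets, each with at least `q`
  -- elements.
  obtain ⟨g, hg_inj, hg⟩ := (Finset.all_card_le_biUnion_card_iff_exists_injective
    (fun i : Q => cball G 1 {R i} \ cball G 1 T)).1 (by
      intro P
      rcases P.eq_empty_or_nonempty with rfl | ⟨i, hi⟩
      · simp
      · calc P.card ≤ q := by simpa [hQcard] using Finset.card_le_univ P
          _ ≤ _ := hA (R i) T (hTU i (hQU i i.2)) hTcard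
          _ ≤ _ := Finset.card_le_card (Finset.subset_biUnion_of_mem
            (fun i : Q => cball G 1 {R i} \ cball G 1 T) hi))
  -- The escape depends only on the position, so the group at `a` stays together, at `φ a`.
  have hφ : ∀ x, ∃ y, x ∉ T → y ∈ cball G 1 {x} \ cball G 1 T := by
    intro x
    by_cases hx : x ∈ T
    · exact ⟨x, fun h => absurd hx h⟩
    · obtain ⟨y, hy⟩ := Finset.card_pos.1 (hq.trans (hA x T hx hTcard))
      exact ⟨y, fun _ => hy⟩
  choose φ hφ using hφ
  let R' : Fin r → V := fun i => if h : i ∈ Q then g ⟨i, h⟩ else if i ∈ U then φ (R i) else R i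
  have hR'U : ∀ i ∈ U, R' i ∈ cball G 1 {R i} \ cball G 1 T := by
    intro i hi
    by_cases hiQ : i ∈ Q
    · simpa only [R', hiQ, dif_pos] using hg ⟨i, hiQ⟩
    · simpa only [R', hiQ, dif_neg, not_false_eq_true, hi, if_true] using hφ _ (hTU i hi)
  obtain ⟨S', hS', hsafe⟩ := hstep R S R' hRS (by
    intro i
    by_cases hi : i ∈ U
    · exact mem_cball_one.1 (Finset.mem_sdiff.1 (hR'U i hi)).1
    · have hiQ : i ∉ Q := fun h => hi (hQU i h)
      simp [R', hi, hiQ])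
  have hU' : ∀ i ∈ U, ∀ k, S' k ≠ R' i := by
    intro i hi k hk
    refine (Finset.mem_sdiff.1 (hR'U i hi)).2 (hk ▸ mem_cball_iff_exists.2
      ⟨S k, Finset.mem_image_of_mem _ (Finset.mem_univ _), move_mem_cball hS' k⟩)
  have hRA : ∀ i ∈ A, R' i = φ a := by
    intro i hi
    have hiQ : i ∉ Q := fun h => hQA i h hi
    simp [R', hiQ, hAU hi, ha i hi]
  have hRQ : Set.InjOn R' Q := by
    intro i hi j hj hij
    have hi' : i ∈ Q := hi
    have hj' : j ∈ Q := hj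
    simp only [R', hi', hj', dif_pos] at hij
    exact congrArg Subtype.val (hg_inj hij)
  -- Either a member of `Q` has landed on the group, or `φ a ∉ B` and `hB` applies.
  by_cases hmeet : φ a ∈ Q.image R'
  · obtain ⟨i, hi, hia⟩ := Finset.mem_image.1 hmeet
    refine ⟨R', S', hsafe, hU', insert i A, Finset.insert_subset (hQU i hi) hAU,
      Finset.card_insert_of_notMem (hQA i hi), φ a, fun l hl => ?_⟩
    rcases Finset.mem_insert.1 hl with rfl | hl
    exacts [hia, hRA l hl]
  · obtain ⟨i₀, hi₀⟩ := hAne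
    obtain ⟨b, hb, w, hwa, hwb, hwS⟩ := hB (φ a) (Finset.univ.image S') (Q.image R')
      (by simpa [← hRA i₀ hi₀] using hU' i₀ (hAU hi₀)) hmeet
      (by
        rw [Finset.disjoint_left]
        intro x hx hx'
        obtain ⟨k, -, rfl⟩ := Finset.mem_image.1 hx
        obtain ⟨i, hi, hik⟩ := Finset.mem_image.1 hx'
        exact hU' i (hQU i hi) k hik.symm)
      (Finset.card_image_le.trans (by simp))
      (by rw [Finset.card_image_of_injOn hRQ, hQcard])
    obtain ⟨i, hi, rfl⟩ := Finset.mem_image.1 hb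
    obtain ⟨R'', S'', h1, h2, h3⟩ := exists_safe_gathered hstep
      (fun x S hx hS => Finset.card_pos.1 (hq.trans (hA x S hx hS))) U (insert i A) w t R' S' hsafe
      hU' (fun l hl => by
        rcases Finset.mem_insert.1 hl with rfl | hl
        · exact mem_cball_comm.1 hwb
        · rw [hRA l hl]; exact mem_cball_comm.1 hwa)
      (fun k hk => hwS (mem_cball_iff_exists.2
        ⟨S' k, Finset.mem_image_of_mem _ (Finset.mem_univ _), mem_cball_comm.1 hk⟩))
    exact ⟨R'', S'', h1, h2, insert i A, Finset.insert_subset (hQU i hi) hAU,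
      Finset.card_insert_of_notMem (hQA i hi), w, h3⟩

/-- If the revolutionaries can evade `s` spies, and a large group and one of any `q` distinct
revolutionaries can always gather ahead of the spies, then `r - m - q` spies do not win. -/
theorem not_spiesWin (hm : 1 ≤ m) (hq : 1 ≤ q) (hr : m + s + q ≤ r) [Nonempty V]
    (hA : ∀ (x : V) (S : Finset V), x ∉ S → S.card ≤ s →
      max 2 q ≤ (cball G 1 {x} \ cball G 1 S).card)
    (hB : ∀ (a : V) (S B : Finset V), a ∉ S → a ∉ B → Disjoint S B → S.card ≤ s → B.card = q →
      ∃ b ∈ B, ∃ w, w ∈ cball G t {a} ∧ w ∈ cball G t {b} ∧ w ∉ cball G t S) :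
    ¬ SpiesWin G r m s := by
  classical
  intro hwin
  obtain ⟨Safe, hinit, hguard, hstep⟩ := hwin.exists_safe
  obtain ⟨R₀, S₀, hRS₀, U, hUcard, hU₀⟩ := exists_safe_unspied hinit hstep
    fun x S hx hS => (le_max_left _ _).trans (hA x S hx hS)
  have hgrow : ∀ n, 1 ≤ n → n ≤ m → ∃ R S, Safe R S ∧ (∀ i ∈ U, ∀ k, S k ≠ R i) ∧
      ∃ A ⊆ U, A.card = n ∧ ∃ a, ∀ i ∈ A, R i = a := by
    intro n hn
    induction n, hn using Nat.le_induction with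
    | base =>
      intro _
      obtain ⟨i, hi⟩ := Finset.card_pos.1 (show 0 < U.card by omega)
      exact ⟨R₀, S₀, hRS₀, hU₀, {i}, by simpa using hi, by simp, R₀ i, by simp⟩
    | succ n hn ih =>
      intro hnm
      obtain ⟨R, S, hRS, hU, A, hAU, hAcard, a, ha⟩ := ih (by omega)
      -- Since `m + q ≤ U.card`, there are still `q` members of `U` outside `A`.
      obtain ⟨R', S', h1, h2, A', h3, h4, h5⟩ := exists_safe_insert hstep hq
        (fun x S hx hS => (le_max_right _ _).trans (hA x S hx hS)) hB U A hAU (by omega)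
        (Finset.card_pos.1 (by omega)) hRS hU ha
      exact ⟨R', S', h1, h2, A', h3, by omega, h5⟩
  obtain ⟨R, S, hRS, hU, A, hAU, hAcard, a, ha⟩ := hgrow m hm le_rfl
  refine hguard R S hRS ⟨a, ?_, ?_⟩
  · rw [← hAcard, ← Set.ncard_coe_finset]
    exact Set.ncard_le_ncard (fun i hi => ha i hi) (Set.toFinite _)
  · obtain ⟨i, hi⟩ := Finset.card_pos.1 (show 0 < A.card by omega)
    intro k
    rw [← ha i hi]
    exact hU i (hAU hi) k

end Strategy

end RevSpies

namespace RevSpies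

/-! ### Random sets with an adaptively revealed part. -/

section Reveal

variable {α : Type*} [DecidableEq α]

/-- The binomial moment generating function: each element of `T` contributes a factor `1 - p + p *
x`, every other element a factor `1`. -/
lemma sum_powerset_weight (E T : Finset α) (hT : T ⊆ E) (p x : ℝ) :
    ∑ B ∈ E.powerset, p ^ B.card * (1 - p) ^ (E.card - B.card) * x ^ (B ∩ T).card =
      (1 + p * (x - 1)) ^ T.card := by
  have h := Finset.prod_add (fun e => p * if e ∈ T then x else 1) (fun _ => 1 - p) E
  have h1 : ∏ e ∈ E, ((p * if e ∈ T then x else 1) + (1 - p)) = (1 + p * (x - 1)) ^ T.card := by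
    rw [← Finset.prod_const, ← Finset.prod_subset hT]
    · refine Finset.prod_congr rfl fun e he => ?_
      simp only [he, if_true]; ring
    · intro e _ he
      simp only [he, if_false]; ring
  rw [← h1, h]
  refine Finset.sum_congr rfl fun B hB => ?_
  rw [Finset.prod_mul_distrib, Finset.prod_const, Finset.prod_const,
    Finset.card_sdiff_of_subset (Finset.mem_powerset.1 hB), Finset.prod_ite_mem, Finset.prod_const]
  ring

/-- Independence of the parts of the random set inside and outside `D`. -/
lemma sum_filter_inter_eq (E D A : Finset α) (hD : D ⊆ E) (hA : A ⊆ D) (p : ℝ)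
    (h : Finset α → ℝ) :
    ∑ ω ∈ E.powerset.filter (fun ω => ω ∩ D = A),
        p ^ ω.card * (1 - p) ^ (E.card - ω.card) * h (ω \ D) =
      p ^ A.card * (1 - p) ^ (D.card - A.card) * ∑ B ∈ (E \ D).powerset,
        p ^ B.card * (1 - p) ^ ((E \ D).card - B.card) * h B := by
  rw [Finset.mul_sum]
  refine Finset.sum_nbij' (fun ω => ω \ D) (fun B => A ∪ B) ?_ ?_ ?_ ?_ ?_
  · intro ω hω
    simp only [Finset.mem_filter, Finset.mem_powerset] at hω ⊢
    exact Finset.sdiff_subset_sdiff hω.1 subset_rfl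
  · intro B hB
    simp only [Finset.mem_filter, Finset.mem_powerset] at hB ⊢
    refine ⟨Finset.union_subset (hA.trans hD) (hB.trans Finset.sdiff_subset), ?_⟩
    ext e
    have := @hB e
    have := @hA e
    simp only [Finset.mem_sdiff, Finset.mem_inter, Finset.mem_union] at *
    tauto
  · intro ω hω
    simp only [Finset.mem_filter, Finset.mem_powerset] at hω
    rw [← hω.2, Finset.union_comm]
    exact Finset.sdiff_union_inter ω D
  · intro B hB
    simp only [Finset.mem_powerset] at hB
    ext e
    have := @hB e
    have := @hA e
    simp only [Finset.mem_sdiff, Finset.mem_union] at *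
    tauto
  · intro ω hω
    simp only [Finset.mem_filter, Finset.mem_powerset] at hω
    have h1 : ω.card = A.card + (ω \ D).card := by
      rw [← hω.2, add_comm, Finset.card_sdiff_add_card_inter]
    have h2 := Finset.card_le_card (Finset.sdiff_subset_sdiff hω.1 (subset_refl D))
    have h3 := Finset.card_le_card hA
    have h4 := Finset.card_sdiff_add_card_eq_card hD
    have h5 : E.card - ω.card = (D.card - A.card) + ((E \ D).card - (ω \ D).card) := by omega
    rw [h5, h1, pow_add, pow_add]
    ring

/-- The moment generating function of the number of elements of a random set in an adaptively
chosen set `T ω`, where `T ω` is determined by the part of `ω` in the revealed set `D ω`. -/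
lemma sum_adaptive (E : Finset α) (p x : ℝ) (hy : 1 + p * (x - 1) ≠ 0)
    (D T : Finset α → Finset α) (hD : ∀ ω ⊆ E, D ω ⊆ E) (hT : ∀ ω ⊆ E, T ω ⊆ E)
    (hDT : ∀ ω ⊆ E, Disjoint (D ω) (T ω))
    (hadapt : ∀ ω ⊆ E, ∀ ω' ⊆ E, (∀ e ∈ D ω, e ∈ ω ↔ e ∈ ω') → D ω' = D ω ∧ T ω' = T ω) :
    ∑ ω ∈ E.powerset, p ^ ω.card * (1 - p) ^ (E.card - ω.card) *
      (x ^ (ω ∩ T ω).card / (1 + p * (x - 1)) ^ (T ω).card) = 1 := by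
  -- The sum is split by the revealed information. On each fibre `T` is constant and untouched, so
  -- the normalised moment averages to `1`.
  have hkey : ∀ g : Finset α → ℝ, ∑ ω ∈ E.powerset, g ω =
      ∑ κ ∈ E.powerset.image (fun ω => (D ω, ω ∩ D ω)),
        ∑ ω ∈ E.powerset.filter (fun ω => (D ω, ω ∩ D ω) = κ), g ω := fun g =>
    (Finset.sum_fiberwise_of_maps_to (fun ω hω => Finset.mem_image_of_mem _ hω) g).symm
  have htot : ∑ ω ∈ E.powerset, p ^ ω.card * (1 - p) ^ (E.card - ω.card) = 1 := by
    rw [Finset.sum_pow_mul_eq_add_pow]; simp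
  refine Eq.trans ?_ htot
  rw [hkey, hkey fun ω => p ^ ω.card * (1 - p) ^ (E.card - ω.card)]
  refine Finset.sum_congr rfl fun κ hκ => ?_
  obtain ⟨ω₀, hω₀, rfl⟩ := Finset.mem_image.1 hκ
  rw [Finset.mem_powerset] at hω₀
  -- By adaptivity, fibres are cylinders over the fixed set `D ω₀`.
  have hfib : E.powerset.filter (fun ω => (D ω, ω ∩ D ω) = (D ω₀, ω₀ ∩ D ω₀)) =
      E.powerset.filter (fun ω => ω ∩ D ω₀ = ω₀ ∩ D ω₀) := by
    refine Finset.filter_congr fun ω hω => ?_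
    rw [Finset.mem_powerset] at hω
    constructor
    · intro h
      rw [Prod.mk.injEq] at h
      rw [← h.2, h.1]
    · intro h
      have := (hadapt ω₀ hω₀ ω hω fun e he => by
        have := congrArg (e ∈ ·) h
        simp only [Finset.mem_inter, he, and_true, eq_iff_iff] at this
        exact this.symm).1
      rw [this, h]
  have hTfib : ∀ ω ∈ E.powerset.filter (fun ω => ω ∩ D ω₀ = ω₀ ∩ D ω₀),
      T ω = T ω₀ ∧ ω ∩ T ω₀ = (ω \ D ω₀) ∩ T ω₀ := by
    intro ω hω
    rw [Finset.mem_filter, Finset.mem_powerset] at hω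
    refine ⟨(hadapt ω₀ hω₀ ω hω.1 fun e he => by
        have := congrArg (e ∈ ·) hω.2
        simp only [Finset.mem_inter, he, and_true, eq_iff_iff] at this
        exact this.symm).2, ?_⟩
    ext e
    have hn : e ∈ T ω₀ → e ∉ D ω₀ := fun h => Finset.disjoint_right.1 (hDT ω₀ hω₀) h
    simp only [Finset.mem_inter, Finset.mem_sdiff]
    tauto
  have hTsub : T ω₀ ⊆ E \ D ω₀ := fun e he => Finset.mem_sdiff.2
    ⟨hT _ hω₀ he, Finset.disjoint_right.1 (hDT ω₀ hω₀) he⟩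
  rw [hfib]
  have e1 := sum_filter_inter_eq E (D ω₀) (ω₀ ∩ D ω₀) (hD _ hω₀) Finset.inter_subset_right p
    (fun B => x ^ (B ∩ T ω₀).card / (1 + p * (x - 1)) ^ (T ω₀).card)
  have e2 := sum_filter_inter_eq E (D ω₀) (ω₀ ∩ D ω₀) (hD _ hω₀) Finset.inter_subset_right p
    (fun _ => 1)
  have e3 := sum_powerset_weight (E \ D ω₀) (T ω₀) hTsub p x
  have e4 : ∑ B ∈ (E \ D ω₀).powerset, p ^ B.card * (1 - p) ^ ((E \ D ω₀).card - B.card) = 1 := by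
    rw [Finset.sum_pow_mul_eq_add_pow]; simp
  simp only [mul_one] at e2
  rw [e2, e4, mul_one]
  refine Eq.trans ?_ (e1.trans ?_)
  · refine Finset.sum_congr rfl fun ω hω => ?_
    rw [(hTfib ω hω).1, (hTfib ω hω).2]
  · simp only [← mul_div_assoc]
    rw [← Finset.sum_div, e3, div_self (pow_ne_zero _ hy), mul_one]

end Reveal

/-! ### Transfer to the binomial random graph. -/

section Measure

open MeasureTheory SimpleGraph

variable {V : Type*} [Fintype V] [DecidableEq V]

lemma measurableSingletonClass_simpleGraph (W : Type*) [Countable W] :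
    MeasurableSingletonClass (SimpleGraph W) :=
  ⟨fun G =>
    measurableEmbedding_edgeSet.measurableSet_image.1 (by
        rw [Set.image_singleton]
        exact measurableSet_singleton _)⟩

open Classical in
lemma binomialRandom_real_eq_sum (p : unitInterval) (𝒮 : Set (SimpleGraph V)) :
    (binomialRandom V p).real 𝒮 =
      ∑ ω ∈ (Finset.univ.filter fun e : Sym2 V => ¬ e.IsDiag).powerset,
        if fromEdgeSet (ω : Set (Sym2 V)) ∈ 𝒮 then (p : ℝ) ^ ω.card * (1 - (p : ℝ)) ^
          ((Finset.univ.filter fun e : Sym2 V => ¬ e.IsDiag).card - ω.card) else 0 := by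
  have hE : (Finset.univ.filter fun e : Sym2 V => ¬ e.IsDiag).card =
      (Nat.card V).choose 2 := by
    rw [Nat.card_eq_fintype_card, ← Sym2.card_diagSet_compl, Fintype.card_subtype]
    congr 1
  have := measurableSingletonClass_simpleGraph V
  have h1 : (binomialRandom V p).real 𝒮 = ∑ G ∈ Finset.univ.filter (· ∈ 𝒮),
      (binomialRandom V p).real {G} := by
    rw [sum_measureReal_singleton]
    simp
  rw [h1, Finset.sum_filter]
  refine Finset.sum_nbij' (fun G => G.edgeFinset) (fun ω => fromEdgeSet (ω : Set (Sym2 V)))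
    ?_ ?_ ?_ ?_ ?_
  · intro G _
    rw [Finset.mem_powerset]
    intro e he
    simpa using G.not_isDiag_of_mem_edgeFinset he
  · simp
  · intro G _
    simp
  · intro ω hω
    rw [Finset.mem_powerset] at hω
    ext e
    have := @hω e
    simp only [Finset.mem_filter, Finset.mem_univ, true_and] at this
    simp only [mem_edgeFinset, edgeSet_fromEdgeSet]
    simp
    exact this
  · intro G _
    simp only [coe_edgeFinset, fromEdgeSet_edgeSet]
    split_ifs with h
    · rw [hE, measureReal_def, binomialRandom_singleton, ← coe_edgeFinset, Set.ncard_coe_finset]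
      simp
    · rfl

open Classical in
/-- Markov's inequality for the number of edges in a set of pairs that is chosen after the edges at
the vertices of `Z G` have been revealed. -/
lemma binomialRandom_real_le_of_reveal (p : unitInterval) {x c : ℝ} (hx : 0 ≤ x) (hc : 0 < c)
    (hy : 0 < 1 + (p : ℝ) * (x - 1)) (Z : SimpleGraph V → Finset V)
    (T : SimpleGraph V → Finset (Sym2 V))
    (hT : ∀ G, ∀ e ∈ T G, ¬ e.IsDiag ∧ ∀ v ∈ e, v ∉ Z G)
    (hadapt : ∀ G G' : SimpleGraph V, (∀ v ∈ Z G, ∀ u, G.Adj v u ↔ G'.Adj v u) →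
      Z G' = Z G ∧ T G' = T G)
    (𝒮 : Set (SimpleGraph V))
    (h𝒮 : ∀ G ∈ 𝒮, c ≤ x ^ ((T G).filter (· ∈ G.edgeSet)).card /
      (1 + (p : ℝ) * (x - 1)) ^ (T G).card) :
    (binomialRandom V p).real 𝒮 ≤ 1 / c := by
  set E := Finset.univ.filter fun e : Sym2 V => ¬ e.IsDiag with hE
  let Γ : Finset (Sym2 V) → SimpleGraph V := fun ω => fromEdgeSet (ω : Set (Sym2 V))
  let D : Finset (Sym2 V) → Finset (Sym2 V) := fun ω => E.filter fun e => ∃ v ∈ e, v ∈ Z (Γ ω)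
  have hΓ : ∀ ω ⊆ E, ∀ e, e ∈ (Γ ω).edgeSet ↔ e ∈ ω := by
    intro ω hω e
    have := @hω e
    simp only [hE, Finset.mem_filter, Finset.mem_univ, true_and] at this
    simp [Γ]
    exact this
  have hp0 : (0 : ℝ) ≤ p := p.2.1
  have hp1 : (0 : ℝ) ≤ 1 - p := sub_nonneg.2 p.2.2
  have hsum := sum_adaptive E p x hy.ne' D (fun ω => T (Γ ω)) (fun _ _ => Finset.filter_subset _ _)
    (fun ω _ e he => by simpa [hE] using (hT _ e he).1)
    (fun ω _ => by
      rw [Finset.disjoint_left]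
      intro e he he'
      obtain ⟨v, hv, hvZ⟩ := (Finset.mem_filter.1 he).2
      exact (hT _ e he').2 v hv hvZ)
    (by
      intro ω hω ω' hω' h
      have := hadapt (Γ ω) (Γ ω') (by
        intro v hv u
        rw [← mem_edgeSet, ← mem_edgeSet, hΓ ω hω, hΓ ω' hω']
        by_cases hvu : v = u
        · subst hvu
          have hd : s(v, v) ∉ E := by simp [hE]
          exact iff_of_false (fun h => hd (hω h)) (fun h => hd (hω' h))
        · refine h _ (Finset.mem_filter.2 ⟨by simpa [hE] using hvu, v, by simp, hv⟩))
      exact ⟨by simp only [D, this.1], this.2⟩)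
  rw [binomialRandom_real_eq_sum, le_div_iff₀ hc, Finset.sum_mul]
  refine le_of_le_of_eq ?_ hsum
  refine Finset.sum_le_sum fun ω hω => ?_
  rw [Finset.mem_powerset] at hω
  have hinter : ω ∩ T (Γ ω) = (T (Γ ω)).filter (· ∈ (Γ ω).edgeSet) := by
    ext e
    simp only [Finset.mem_inter, Finset.mem_filter, hΓ ω hω, and_comm]
  have hw : 0 ≤ (p : ℝ) ^ ω.card * (1 - (p : ℝ)) ^ (E.card - ω.card) :=
    mul_nonneg (pow_nonneg hp0 _) (pow_nonneg hp1 _)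
  split_ifs with h
  · refine mul_le_mul_of_nonneg_left (le_of_le_of_eq (h𝒮 (Γ ω) h) ?_) hw
    rw [hinter]
    congr!
  · rw [zero_mul]
    exact mul_nonneg hw (div_nonneg (pow_nonneg hx _) (pow_nonneg hy.le _))

end Measure

end RevSpies

namespace RevSpies

/-! ### Exploration of balls and their unrevealed pairs. -/

section Exploration

variable {V : Type*} [Fintype V] [DecidableEq V] {G G' : SimpleGraph V} {X Y : Finset V}
  {u v w : V} {i j : ℕ}

/-- The vertices at distance less than `j` from the set `X`. -/
noncomputable def pball (G : SimpleGraph V) : ℕ → Finset V → Finset V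
  | 0, _ => ∅
  | j + 1, X => cball G j X

lemma pball_subset_cball : pball G j X ⊆ cball G j X := by
  cases j with
  | zero => exact Finset.empty_subset _
  | succ j => exact cball_subset_succ

/-- A ball is determined by the edges at the vertices of the next smaller ball. This is the source
of adaptivity. -/
lemma cball_congr (h : ∀ v ∈ pball G j X, ∀ u, G.Adj v u ↔ G'.Adj v u) :
    ∀ i ≤ j, cball G' i X = cball G i X := by
  intro i
  induction i with
  | zero => simp
  | succ i ih =>
    intro hi
    have hsub : cball G i X ⊆ pball G j X := by
      obtain ⟨j, rfl⟩ : ∃ l, j = l + 1 := ⟨j - 1, by omega⟩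
      exact cball_subset_of_le (by omega)
    ext v
    rw [mem_cball_succ, mem_cball_succ, ih (by omega)]
    exact exists_congr fun u => and_congr_right fun hu => or_congr_right (h u (hsub hu) v).symm

lemma pball_congr (h : ∀ v ∈ pball G j X, ∀ u, G.Adj v u ↔ G'.Adj v u) :
    pball G' j X = pball G j X := by
  cases j with
  | zero => rfl
  | succ j => exact cball_congr h j (Nat.le_succ j)

open Classical in
/-- The number of neighbours of `v`. -/
noncomputable def dg (G : SimpleGraph V) (v : V) : ℕ := (Finset.univ.filter fun u => G.Adj v u).card

lemma card_cball_one : (cball G 1 {v}).card = dg G v + 1 := by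
  classical
  have : cball G 1 {v} = insert v (Finset.univ.filter fun u => G.Adj v u) := by
    ext u
    simp [mem_cball_one]
  rw [this, Finset.card_insert_of_notMem (by simp), dg]

lemma card_cball_succ_le {Δ : ℕ} (h : ∀ v, (cball G 1 {v}).card ≤ Δ) :
    (cball G (j + 1) X).card ≤ (cball G j X).card * Δ := by
  have : cball G (j + 1) X = (cball G j X).biUnion fun u => cball G 1 {u} := by
    ext v
    simp [mem_cball_succ (j := j), mem_cball_one]
  rw [this]
  exact Finset.card_biUnion_le_card_mul _ _ _ fun u _ => h u

lemma card_cball_le {Δ : ℕ} (h : ∀ v, (cball G 1 {v}).card ≤ Δ) :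
    (cball G j X).card ≤ X.card * Δ ^ j := by
  induction j with
  | zero => simp
  | succ j ih =>
    calc _ ≤ _ := card_cball_succ_le h
      _ ≤ _ := Nat.mul_le_mul_right _ ih
      _ = _ := by ring

/-- The vertices whose neighbourhoods are revealed in the exploration of the balls of radius
`i + 1` around `u` and of radius `i` around `v`. -/
noncomputable def crossReveal (G : SimpleGraph V) (i : ℕ) (u v : V) : Finset V :=
  cball G i {u} ∪ pball G i {v}

/-- The unrevealed pairs that join the ball of radius `i + 1` around `u` to the ball of radius `i`
around `v`. -/
noncomputable def crossPairs (G : SimpleGraph V) (i : ℕ) (u v : V) : Finset (Sym2 V) :=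
  (((cball G (i + 1) {u} \ crossReveal G i u v) ×ˢ (cball G i {v} \ crossReveal G i u v)).image
    fun a => s(a.1, a.2)).filter fun e => ¬ e.IsDiag

open Classical in
/-- The number of edges among the pairs `crossPairs G i u v`. -/
noncomputable def crossEdges (G : SimpleGraph V) (i : ℕ) (u v : V) : ℕ :=
  ((crossPairs G i u v).filter (· ∈ G.edgeSet)).card

lemma card_crossPairs_le :
    (crossPairs G i u v).card ≤ (cball G (i + 1) {u}).card * (cball G i {v}).card := by
  refine (Finset.card_filter_le _ _).trans (Finset.card_image_le.trans ?_)
  rw [Finset.card_product]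
  exact Nat.mul_le_mul (Finset.card_le_card Finset.sdiff_subset)
    (Finset.card_le_card Finset.sdiff_subset)

lemma crossReveal_congr (h : ∀ x ∈ crossReveal G i u v, ∀ y, G.Adj x y ↔ G'.Adj x y) :
    crossReveal G' i u v = crossReveal G i u v ∧ crossPairs G' i u v = crossPairs G i u v := by
  have h1 := cball_congr (G := G) (G' := G') (X := {u}) (j := i + 1)
    fun x hx => h x (Finset.mem_union_left _ hx)
  have h2 : ∀ x ∈ pball G i {v}, ∀ y, G.Adj x y ↔ G'.Adj x y :=
    fun x hx => h x (Finset.mem_union_right _ hx)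
  have h3 : crossReveal G' i u v = crossReveal G i u v := by
    rw [crossReveal, crossReveal, h1 i (by omega), pball_congr h2]
  refine ⟨h3, ?_⟩
  rw [crossPairs, crossPairs, h3, h1 (i + 1) le_rfl, cball_congr h2 i le_rfl]

/-- Two balls of radius `i + 1` can only meet in the smaller balls, behind the vertices that the
balls of radius `i` share, or at the crossing edges. -/
lemma card_cball_inter_succ_le {Δ : ℕ} (h : ∀ v, (cball G 1 {v}).card ≤ Δ) :
    (cball G (i + 1) {u} ∩ cball G (i + 1) {v}).card ≤
      2 * Δ ^ i + (cball G i {u} ∩ cball G i {v}).card * Δ + 2 * crossEdges G i u v := by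
  classical
  set C := (crossPairs G i u v).filter (· ∈ G.edgeSet) with hC
  have hsub : cball G (i + 1) {u} ∩ cball G (i + 1) {v} ⊆
      ((cball G i {u} ∪ cball G i {v}) ∪
        (cball G i {u} ∩ cball G i {v}).biUnion fun y => cball G 1 {y}) ∪
        C.biUnion fun e => e.toFinset := by
    intro w hw
    rw [Finset.mem_inter] at hw
    by_cases hwu : w ∈ cball G i {u}
    · simp [hwu]
    by_cases hwv : w ∈ cball G i {v}
    · simp [hwv]
    obtain ⟨y, hy, hyw⟩ := mem_cball_succ.1 hw.2
    have hadj : G.Adj y w := hyw.resolve_left fun h => hwv (h ▸ hy)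
    -- Here `w` is at distance exactly `i + 1` from both centres. Its neighbour `y` near `v` is
    -- either shared with `u`, or `yw` is a crossing edge.
    by_cases hyu : y ∈ cball G i {u}
    · refine Finset.mem_union_left _ (Finset.mem_union_right _ (Finset.mem_biUnion.2
        ⟨y, Finset.mem_inter.2 ⟨hyu, hy⟩, mem_cball_one.2 hyw⟩))
    have hyp : y ∉ pball G i {v} := by
      intro hyp
      cases i with
      | zero => simp [pball] at hyp
      | succ i => exact hwv (mem_cball_succ.2 ⟨y, hyp, hyw⟩)
    refine Finset.mem_union_right _ (Finset.mem_biUnion.2 ⟨s(w, y), ?_, by simp⟩)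
    simp only [hC, crossPairs, Finset.mem_filter, Finset.mem_image, Finset.mem_product,
      Finset.mem_sdiff, crossReveal, Finset.mem_union]
    refine ⟨⟨⟨(w, y), ⟨⟨hw.1, ?_⟩, hy, ?_⟩, rfl⟩, by simpa using hadj.ne'⟩, by simpa using hadj.symm⟩
    · exact fun h => h.elim hwu fun h => hwv (pball_subset_cball h)
    · exact fun h => h.elim hyu hyp
  refine (Finset.card_le_card hsub).trans ?_
  refine (Finset.card_union_le _ _).trans (add_le_add ?_ ?_)
  · refine (Finset.card_union_le _ _).trans (add_le_add ?_ ?_)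
    · refine (Finset.card_union_le _ _).trans ?_
      have h1 := card_cball_le (j := i) (X := {u}) h
      have h2 := card_cball_le (j := i) (X := {v}) h
      simp only [Finset.card_singleton, one_mul] at h1 h2
      omega
    · exact Finset.card_biUnion_le_card_mul _ _ _ fun y _ => h y
  · refine (Finset.card_biUnion_le_card_mul _ _ 2 fun e _ => ?_).trans ?_
    · exact (Sym2.card_toFinset e).trans_le (by split_ifs <;> simp)
    · rw [mul_comm, crossEdges]

/-- The vertices whose neighbourhoods are revealed before the meetings of `a` with `B` are sought
in the ball of radius `i + 1` around `a` away from `S`. -/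
noncomputable def meetReveal (G : SimpleGraph V) (i : ℕ) (a : V) (S B : Finset V) : Finset V :=
  cball G i {a} ∪ cball G i S ∪ pball G i B

/-- The candidates for a meeting vertex. -/
noncomputable def meetLeft (G : SimpleGraph V) (i : ℕ) (a : V) (S B : Finset V) : Finset V :=
  cball G (i + 1) {a} \ (cball G (i + 1) S ∪ meetReveal G i a S B)

/-- The vertices from which `B` may reach a meeting vertex by an unrevealed edge. -/
noncomputable def meetRight (G : SimpleGraph V) (i : ℕ) (a : V) (S B : Finset V) : Finset V :=
  cball G i B \ (meetReveal G i a S B ∪ meetLeft G i a S B)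

lemma meetReveal_congr {a : V} {S B : Finset V}
    (h : ∀ x ∈ meetReveal G i a S B, ∀ y, G.Adj x y ↔ G'.Adj x y) :
    meetReveal G' i a S B = meetReveal G i a S B ∧ meetLeft G' i a S B = meetLeft G i a S B ∧
      meetRight G' i a S B = meetRight G i a S B := by
  have h1 := cball_congr (G := G) (G' := G') (X := {a}) (j := i + 1)
    fun x hx => h x (Finset.mem_union_left _ (Finset.mem_union_left _ hx))
  have h2 := cball_congr (G := G) (G' := G') (X := S) (j := i + 1)
    fun x hx => h x (Finset.mem_union_left _ (Finset.mem_union_right _ hx))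
  have h3 : ∀ x ∈ pball G i B, ∀ y, G.Adj x y ↔ G'.Adj x y :=
    fun x hx => h x (Finset.mem_union_right _ hx)
  have h4 : meetReveal G' i a S B = meetReveal G i a S B := by
    rw [meetReveal, meetReveal, h1 i (by omega), h2 i (by omega), pball_congr h3]
  have h5 : meetLeft G' i a S B = meetLeft G i a S B := by
    rw [meetLeft, meetLeft, h4, h1 (i + 1) le_rfl, h2 (i + 1) le_rfl]
  exact ⟨h4, h5, by rw [meetRight, meetRight, h4, h5, cball_congr h3 i le_rfl]⟩

/-- Some vertex `w` is within distance `t` of `a` and of some `b ∈ B`, but not of `S`. -/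
def CanMeet (G : SimpleGraph V) (t : ℕ) (a : V) (S B : Finset V) : Prop :=
  ∃ b ∈ B, ∃ w, w ∈ cball G t {a} ∧ w ∈ cball G t {b} ∧ w ∉ cball G t S

lemma canMeet_of_adj {a : V} {S B : Finset V} {x y : V} (hx : x ∈ meetLeft G i a S B)
    (hy : y ∈ meetRight G i a S B) (hxy : G.Adj x y) : CanMeet G (i + 1) a S B := by
  rw [meetLeft, Finset.mem_sdiff, Finset.mem_union, not_or] at hx
  rw [meetRight, Finset.mem_sdiff] at hy
  obtain ⟨b, hb, hyb⟩ := mem_cball_iff_exists.1 hy.1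
  exact ⟨b, hb, x, hx.1, mem_cball_succ.2 ⟨y, hyb, Or.inr hxy.symm⟩, hx.2.1⟩

/-- A candidate within distance `i` of `B` would already be a meeting vertex. So when no meeting is
possible, removing `meetLeft` in `meetRight` costs nothing. -/
lemma disjoint_of_not_canMeet {a : V} {S B : Finset V} (h : ¬ CanMeet G (i + 1) a S B) :
    Disjoint (cball G i B) (meetLeft G i a S B) := by
  rw [Finset.disjoint_left]
  intro x hxB hx
  rw [meetLeft, Finset.mem_sdiff, Finset.mem_union, not_or] at hx
  obtain ⟨b, hb, hxb⟩ := mem_cball_iff_exists.1 hxB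
  exact h ⟨b, hb, x, hx.1, cball_subset_succ hxb, hx.2.1⟩

end Exploration

/-! ### Tail bounds from the revealing inequality. -/

section Probability

open MeasureTheory SimpleGraph

variable {V : Type*} [Fintype V] [DecidableEq V] (p : unitInterval)

lemma one_add_pow_le_exp {y : ℝ} (hy : 0 ≤ 1 + y) (n : ℕ) : (1 + y) ^ n ≤ Real.exp (y * n) := by
  rw [mul_comm, Real.exp_nat_mul]
  exact pow_le_pow_left₀ hy (by linarith [Real.add_one_le_exp y]) n

/-- Chernoff's bound with a free parameter `x`, applied to the unrevealed crossing pairs. -/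
lemma real_crossEdges_le {x : ℝ} (hx : 1 ≤ x) (i : ℕ) (u v : V) (N K : ℕ) :
    (binomialRandom V p).real {G | (crossPairs G i u v).card ≤ N ∧ K ≤ crossEdges G i u v} ≤
      Real.exp (p * (x - 1) * N) / x ^ K := by
  have hp : (0 : ℝ) ≤ p * (x - 1) := mul_nonneg p.2.1 (by linarith)
  have hx0 : 0 < x := by linarith
  rw [← one_div_div]
  refine binomialRandom_real_le_of_reveal p hx0.le (by positivity) (by linarith)
    (fun G => crossReveal G i u v) (fun G => crossPairs G i u v) ?_
    (fun G G' h => crossReveal_congr h) _ ?_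
  · intro G e he
    rw [crossPairs, Finset.mem_filter, Finset.mem_image] at he
    obtain ⟨⟨⟨a, b⟩, hab, rfl⟩, hd⟩ := he
    simp only [Finset.mem_product, Finset.mem_sdiff] at hab
    refine ⟨hd, fun z hz => ?_⟩
    rcases Sym2.mem_iff.1 hz with rfl | rfl
    exacts [hab.1.2, hab.2.2]
  · rintro G ⟨hN, hK⟩
    have h1 : (1 + (p : ℝ) * (x - 1)) ^ (crossPairs G i u v).card ≤ Real.exp (p * (x - 1) * N) :=
      (pow_le_pow_right₀ (by linarith) hN).trans (one_add_pow_le_exp (by linarith) N)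
    have h2 : x ^ K ≤ x ^ crossEdges G i u v := pow_le_pow_right₀ hx hK
    rw [crossEdges] at h2
    gcongr

/-- With `x = 0` the moment `x ^ count` is the indicator that no unrevealed pair is an edge, because
`0 ^ 0 = 1`. -/
lemma real_not_canMeet_le (hp : (p : ℝ) < 1) (i : ℕ) (a : V) (S B : Finset V) (N : ℕ) :
    (binomialRandom V p).real {G | N ≤ (meetLeft G i a S B).card * (meetRight G i a S B).card ∧
      ¬ CanMeet G (i + 1) a S B} ≤ Real.exp (-(p * N)) := by
  classical
  have hp' : (0 : ℝ) < 1 - p := by linarith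
  have h1 : (1 - (p : ℝ)) ^ N ≤ Real.exp (-(p * N)) := by
    have := one_add_pow_le_exp (y := -(p : ℝ)) (by linarith) N
    rwa [neg_mul, ← sub_eq_add_neg] at this
  refine le_trans ?_ h1
  rw [← one_div_one_div ((1 - (p : ℝ)) ^ N)]
  refine binomialRandom_real_le_of_reveal p (x := 0) le_rfl (by positivity) (by linarith)
    (fun G => meetReveal G i a S B)
    (fun G => (meetLeft G i a S B ×ˢ meetRight G i a S B).image fun z => s(z.1, z.2)) ?_ ?_ _ ?_
  · intro G e he
    obtain ⟨⟨x, y⟩, hxy, rfl⟩ := Finset.mem_image.1 he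
    simp only [Finset.mem_product] at hxy
    have hx := hxy.1
    have hy := hxy.2
    rw [meetRight, Finset.mem_sdiff, Finset.mem_union, not_or] at hy
    refine ⟨?_, ?_⟩
    · rw [Sym2.mk_isDiag_iff]
      intro hxy'
      exact hy.2.2 ((show x = y from hxy') ▸ hx)
    · intro z hz
      rcases Sym2.mem_iff.1 hz with rfl | rfl
      · rw [meetLeft, Finset.mem_sdiff, Finset.mem_union, not_or] at hx
        exact hx.2.2
      · exact hy.2.1
  · intro G G' h
    obtain ⟨h1, h2, h3⟩ := meetReveal_congr h
    exact ⟨h1, by rw [h2, h3]⟩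
  · rintro G ⟨hN, hG⟩
    -- The two sides are disjoint, so no pair is counted twice.
    have hcard : ((meetLeft G i a S B ×ˢ meetRight G i a S B).image
        fun z => s(z.1, z.2)).card = (meetLeft G i a S B).card * (meetRight G i a S B).card := by
      rw [Finset.card_image_of_injOn, Finset.card_product]
      rintro ⟨x, y⟩ hxy ⟨x', y'⟩ hxy' h
      simp only [Finset.coe_product, Set.mem_prod, Finset.mem_coe] at hxy hxy'
      rcases Sym2.eq_iff.1 h with ⟨h1, h2⟩ | ⟨h1, h2⟩
      · exact Prod.ext h1 h2
      · exfalso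
        have hy := hxy'.2
        rw [meetRight, Finset.mem_sdiff, Finset.mem_union, not_or] at hy
        exact hy.2.2 ((show x = y' from h1) ▸ hxy.1)
    have hempty : ((meetLeft G i a S B ×ˢ meetRight G i a S B).image
        fun z => s(z.1, z.2)).filter (· ∈ G.edgeSet) = ∅ := by
      refine Finset.filter_eq_empty_iff.2 fun e he hadj => ?_
      obtain ⟨⟨x, y⟩, hxy, rfl⟩ := Finset.mem_image.1 he
      rw [Finset.mem_product] at hxy
      exact hG (canMeet_of_adj hxy.1 hxy.2 hadj)
    have h2 : (1 + (p : ℝ) * (0 - 1)) = 1 - p := by ring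
    have h3 : (1 - (p : ℝ)) ^ ((meetLeft G i a S B).card * (meetRight G i a S B).card) ≤
        (1 - (p : ℝ)) ^ N := pow_le_pow_of_le_one hp'.le (by linarith [p.2.1]) hN
    rw [h2, hcard]
    refine (one_div_le_one_div_of_le (by positivity) h3).trans (le_of_eq ?_)
    congr 1
    have h4 := congrArg Finset.card hempty
    rw [Finset.card_empty] at h4
    convert (pow_zero (0 : ℝ)).symm

/-- The pairs that contain `v`. -/
def starPairs (v : V) : Finset (Sym2 V) := (Finset.univ.erase v).image fun u => s(v, u)

lemma card_starPairs (v : V) : (starPairs v).card = Fintype.card V - 1 := by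
  rw [starPairs, Finset.card_image_of_injective, Finset.card_erase_of_mem (Finset.mem_univ _),
    Finset.card_univ]
  intro a b h
  exact Sym2.congr_right.1 h

open Classical in
lemma card_starPairs_filter (G : SimpleGraph V) (v : V) :
    ((starPairs v).filter (· ∈ G.edgeSet)).card = dg G v := by
  rw [dg]
  symm
  refine Finset.card_nbij (fun u => s(v, u)) ?_ ?_ ?_
  · intro u hu
    have hu' : G.Adj v u := by simpa using hu
    refine Finset.mem_filter.2 ⟨Finset.mem_image.2 ⟨u, ?_, rfl⟩, hu'⟩
    simpa using hu'.ne'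
  · intro a _ b _ h
    exact Sym2.congr_right.1 h
  · intro e he
    obtain ⟨he, hG⟩ := Finset.mem_filter.1 (Finset.mem_coe.1 he)
    obtain ⟨u, -, rfl⟩ := Finset.mem_image.1 he
    exact ⟨u, by simpa using hG, rfl⟩

/-- Nothing is revealed here. Taking `x > 1` serves the upper tail, `x < 1` the lower one. -/
lemma real_dg_le {x c : ℝ} (hx : 0 < x) (hc : 0 < c) (hy : 0 < 1 + (p : ℝ) * (x - 1)) (v : V)
    (P : ℕ → Prop) (hP : ∀ k, P k → c * Real.exp (p * (x - 1) * (Fintype.card V - 1 : ℕ)) ≤ x ^ k) :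
    (binomialRandom V p).real {G | P (dg G v)} ≤ 1 / c := by
  classical
  refine binomialRandom_real_le_of_reveal p hx.le hc hy (fun _ => ∅) (fun _ => starPairs v) ?_
    (fun _ _ _ => ⟨rfl, rfl⟩) _ ?_
  · intro G e he
    obtain ⟨u, hu, rfl⟩ := Finset.mem_image.1 he
    exact ⟨by simpa using (Finset.ne_of_mem_erase hu).symm, by simp⟩
  · intro G hG
    have h1 := one_add_pow_le_exp hy.le (Fintype.card V - 1)
    have h2 := hP _ hG
    rw [card_starPairs, le_div_iff₀ (by positivity)]
    refine le_trans (mul_le_mul_of_nonneg_left h1 hc.le) (h2.trans (le_of_eq ?_))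
    congr 1
    rw [← card_starPairs_filter]

end Probability

end RevSpies

namespace RevSpies

/-! ### Sizes and overlaps of balls in regular graphs. -/

section Geometry

/-- Each new set loses at most `M` to each earlier one. -/
lemma le_card_biUnion {α β : Type*} [DecidableEq α] [DecidableEq β] (B : Finset α)
    (F : α → Finset β) {L M : ℝ} (hM : 0 ≤ M) (hL : ∀ b ∈ B, L ≤ (F b).card)
    (hF : ∀ b ∈ B, ∀ b' ∈ B, b ≠ b' → ((F b ∩ F b').card : ℝ) ≤ M) :
    B.card * (L - B.card * M) ≤ (B.biUnion F).card := by
  induction B using Finset.induction_on with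
  | empty => simp
  | insert b B hb ih =>
    have ih := ih (fun x hx => hL x (Finset.mem_insert_of_mem hx)) fun x hx y hy =>
      hF x (Finset.mem_insert_of_mem hx) y (Finset.mem_insert_of_mem hy)
    have h1 : ((F b ∩ B.biUnion F).card : ℝ) ≤ B.card * M := by
      rw [Finset.inter_biUnion]
      refine le_trans (Nat.cast_le.2 Finset.card_biUnion_le) ?_
      rw [Nat.cast_sum, ← nsmul_eq_mul]
      refine Finset.sum_le_card_nsmul _ _ _ fun x hx => hF b (Finset.mem_insert_self _ _) x
        (Finset.mem_insert_of_mem hx) ?_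
      rintro rfl
      exact hb hx
    have h2 : ((F b ∪ B.biUnion F).card : ℝ) + (F b ∩ B.biUnion F).card =
        (F b).card + (B.biUnion F).card := by
      exact_mod_cast Finset.card_union_add_card_inter _ _
    have h3 := hL b (Finset.mem_insert_self _ _)
    rw [Finset.biUnion_insert, Finset.card_insert_of_notMem hb]
    push_cast
    nlinarith [mul_nonneg (Nat.cast_nonneg (α := ℝ) B.card) hM]

lemma card_inter_cball_le {V : Type*} [Fintype V] [DecidableEq V] {G : SimpleGraph V} {j : ℕ}
    {X : Finset V} {S : Finset V} {M : ℝ}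
    (h : ∀ v ∈ S, ((X ∩ cball G j {v}).card : ℝ) ≤ M) :
    ((X ∩ cball G j S).card : ℝ) ≤ S.card * M := by
  rw [cball_eq_biUnion, Finset.inter_biUnion]
  refine le_trans (Nat.cast_le.2 Finset.card_biUnion_le) ?_
  rw [Nat.cast_sum, ← nsmul_eq_mul]
  exact Finset.sum_le_card_nsmul _ _ _ h

lemma le_card_sdiff_cast {α : Type*} [DecidableEq α] (A B : Finset α) :
    (A.card : ℝ) - (A ∩ B).card ≤ (A \ B).card := by
  have : ((A \ B).card : ℝ) + (A ∩ B).card = A.card := by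
    exact_mod_cast Finset.card_sdiff_add_card_inter A B
  linarith

/-- All degrees are of order `d`, and there are few edges between the unrevealed parts of any two
balls. -/
structure Regular {n : ℕ} (G : SimpleGraph (Fin n)) (K d : ℝ) (t : ℕ) : Prop where
  le_dg : ∀ v, d / 4 ≤ dg G v
  dg_le : ∀ v, (dg G v : ℝ) ≤ 4 * d
  -- The second term is the order of the mean, `p * d ^ (i + 1) * d ^ i`; the first absorbs
  -- fluctuations.
  cross : ∀ i < t, ∀ u v, u ≠ v → (crossEdges G i u v : ℝ) ≤ K * (d ^ i + d ^ (2 * (i + 1)) / n)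

variable {n : ℕ} {G : SimpleGraph (Fin n)} {K d : ℝ} {t : ℕ}

lemma Regular.exists_card_le (h : Regular G K d t) (hd : 1 ≤ d) :
    ∃ Δ : ℕ, (∀ v, (cball G 1 {v}).card ≤ Δ) ∧ (Δ : ℝ) ≤ 5 * d := by
  refine ⟨⌊5 * d⌋₊, fun v => Nat.le_floor ?_, Nat.floor_le (by linarith)⟩
  rw [card_cball_one]
  push_cast
  linarith [h.dg_le v]

lemma Regular.card_cball_le (h : Regular G K d t) (hd : 1 ≤ d) (j : ℕ) (X : Finset (Fin n)) :
    ((cball G j X).card : ℝ) ≤ X.card * (5 ^ j * d ^ j) := by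
  obtain ⟨Δ, hΔ, hΔd⟩ := h.exists_card_le hd
  calc ((cball G j X).card : ℝ) ≤ X.card * (Δ : ℝ) ^ j := by exact_mod_cast RevSpies.card_cball_le hΔ
    _ ≤ X.card * (5 * d) ^ j := by gcongr
    _ = _ := by rw [mul_pow]

/-- By `card_cball_inter_succ_le`, one more unit of radius multiplies the overlap by at most `5 * d`
and adds terms of the claimed order. The base `10` absorbs both. -/
lemma Regular.card_inter_le (h : Regular G K d t) (hK : 0 ≤ K) (hd : 1 ≤ d) :
    ∀ i < t, ∀ u v, u ≠ v → ((cball G (i + 1) {u} ∩ cball G (i + 1) {v}).card : ℝ) ≤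
      (2 * K + 2) * 10 ^ (i + 1) * (d ^ i + d ^ (2 * (i + 1)) / n) := by
  obtain ⟨Δ, hΔ, hΔd⟩ := h.exists_card_le hd
  intro i
  induction i with
  | zero =>
    intro hi u v huv
    have h1 : ((cball G 1 {u} ∩ cball G 1 {v}).card : ℝ) ≤
        2 * (Δ : ℝ) ^ 0 + (cball G 0 {u} ∩ cball G 0 {v}).card * Δ + 2 * crossEdges G 0 u v := by
      exact_mod_cast card_cball_inter_succ_le hΔ
    have h2 := h.cross 0 hi u v huv
    have h3 : cball G 0 {u} ∩ cball G 0 {v} = ∅ := by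
      exact Finset.singleton_inter_of_notMem (by simpa using huv)
    rw [h3] at h1
    have h4 : 0 ≤ d ^ (2 * (0 + 1)) / (n : ℝ) := by positivity
    simp only [pow_zero, Finset.card_empty, Nat.cast_zero, zero_mul, zero_add, pow_one] at h1 h2 h4 ⊢
    nlinarith [mul_nonneg hK h4]
  | succ i ih =>
    intro hi u v huv
    have ih := ih (by omega) u v huv
    have h1 : ((cball G (i + 1 + 1) {u} ∩ cball G (i + 1 + 1) {v}).card : ℝ) ≤
        2 * (Δ : ℝ) ^ (i + 1) + (cball G (i + 1) {u} ∩ cball G (i + 1) {v}).card * Δ +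
          2 * crossEdges G (i + 1) u v := by
      exact_mod_cast card_cball_inter_succ_le hΔ
    have h2 := h.cross (i + 1) hi u v huv
    have h3 : (Δ : ℝ) ^ (i + 1) ≤ 10 ^ (i + 1) * d ^ (i + 1) := by
      calc (Δ : ℝ) ^ (i + 1) ≤ (5 * d) ^ (i + 1) := by gcongr
        _ ≤ (10 * d) ^ (i + 1) := by gcongr; norm_num
        _ = _ := mul_pow _ _ _
    set P := d ^ (i + 1) with hP
    set Q := d ^ (2 * (i + 1 + 1)) / (n : ℝ) with hQ
    have hP0 : 0 ≤ P := by positivity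
    have hQ0 : 0 ≤ Q := by positivity
    have h4 : (d ^ i + d ^ (2 * (i + 1)) / n) * d ≤ P + Q := by
      have e1 : d ^ i * d = P := (pow_succ d i).symm
      have e2 : d ^ (2 * (i + 1)) / n * d ≤ Q := by
        rw [hQ, div_mul_eq_mul_div, ← pow_succ]
        gcongr
        omega
      rw [add_mul, e1]
      linarith
    have hA : (1 : ℝ) ≤ 10 ^ (i + 1) := one_le_pow₀ (by norm_num)
    set A : ℝ := 10 ^ (i + 1) with hAdef
    have h5 : ((cball G (i + 1) {u} ∩ cball G (i + 1) {v}).card : ℝ) * Δ ≤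
        5 * ((2 * K + 2) * A * (P + Q)) := by
      calc _ ≤ ((2 * K + 2) * A * (d ^ i + d ^ (2 * (i + 1)) / n)) * (5 * d) := by
            gcongr
        _ = 5 * ((2 * K + 2) * A * ((d ^ i + d ^ (2 * (i + 1)) / n) * d)) := by ring
        _ ≤ _ := by gcongr
    have h6 : (10 : ℝ) ^ (i + 1 + 1) = 10 * A := by rw [pow_succ, hAdef]; ring
    rw [h6]
    have h7 : K * (P + Q) ≤ A * (K * (P + Q)) :=
      le_mul_of_one_le_left (by positivity) hA
    have h8 : 0 ≤ A * (K * (P + Q)) := by positivity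
    have h9 : 0 ≤ A * Q := by positivity
    have h10 : 0 ≤ A * P := by positivity
    nlinarith

/-- The balls of radius `j` have at least `c * d ^ j` vertices. -/
lemma exists_le_card_cball {C : ℝ} (hC : 1 ≤ C) (j : ℕ) :
    ∃ c D : ℝ, 0 < c ∧ c ≤ 1 / 4 ∧ ∀ (n : ℕ) (G : SimpleGraph (Fin n)) (d : ℝ), D ≤ d → 1 ≤ d →
      (∀ v, d / 4 ≤ dg G v) → (∀ i < j, ∀ u v, u ≠ v →
        ((cball G i {u} ∩ cball G i {v}).card : ℝ) * d ≤ C * d ^ i) →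
      ∀ v, c * d ^ j ≤ (cball G j {v}).card := by
  induction j with
  | zero =>
    refine ⟨1 / 4, 0, by norm_num, le_rfl, fun n G d _ _ _ _ v => ?_⟩
    norm_num
  | succ j ih =>
    obtain ⟨c, D, hc0, hc, ih⟩ := ih
    -- Only `γ * d` neighbours of `v` are used, so that the overlaps cost each of their balls at
    -- most half of its guaranteed size.
    set γ := c / (2 * C) with hγ
    have hγ0 : 0 < γ := by positivity
    have hγ1 : γ ≤ 1 / 4 := by
      rw [hγ, div_le_iff₀ (by positivity)]
      linarith
    refine ⟨γ * c / 4, max D (1 / γ), by positivity, by nlinarith, ?_⟩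
    intro n G d hD hd hdg hI v
    have ih := ih n G d ((le_max_left _ _).trans hD) hd hdg fun i hi => hI i (by omega)
    have hγd : 1 ≤ γ * d := by
      have := (le_max_right _ _).trans hD
      rwa [div_le_iff₀' hγ0] at this
    have hx1 : (⌊γ * d⌋₊ : ℝ) ≤ γ * d := Nat.floor_le (by positivity)
    have hx2 : γ * d / 2 ≤ (⌊γ * d⌋₊ : ℝ) := by
      have h1 := Nat.lt_floor_add_one (γ * d)
      have h2 : (1 : ℝ) ≤ ⌊γ * d⌋₊ := by exact_mod_cast Nat.le_floor (by simpa using hγd)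
      linarith
    obtain ⟨X, hX, hXcard⟩ : ∃ X ⊆ cball G 1 {v}, X.card = ⌊γ * d⌋₊ := by
      refine Finset.exists_subset_card_eq ?_
      rw [card_cball_one]
      have : (⌊γ * d⌋₊ : ℝ) ≤ dg G v := by nlinarith [hdg v]
      have : ⌊γ * d⌋₊ ≤ dg G v := by exact_mod_cast this
      omega
    have hM : 0 ≤ C * d ^ j / d := by positivity
    have hU := le_card_biUnion X (fun x => cball G j {x}) hM (fun x _ => ih x)
      fun x _ y _ hxy => by
        rw [le_div_iff₀ (by linarith)]
        exact hI j (by omega) x y hxy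
    have hsub : X.biUnion (fun x => cball G j {x}) ⊆ cball G (j + 1) {v} := by
      rw [← cball_eq_biUnion, cball_succ_eq]
      exact cball_mono hX
    have hcard : ((X.biUnion fun x => cball G j {x}).card : ℝ) ≤ (cball G (j + 1) {v}).card := by
      exact_mod_cast Finset.card_le_card hsub
    refine le_trans ?_ (hU.trans hcard)
    rw [hXcard]
    have h1 : (⌊γ * d⌋₊ : ℝ) * (C * d ^ j / d) ≤ c * d ^ j / 2 := by
      calc (⌊γ * d⌋₊ : ℝ) * (C * d ^ j / d) ≤ γ * d * (C * d ^ j / d) := by gcongr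
        _ = c * d ^ j / 2 := by
          rw [hγ]
          have : d ≠ 0 := by positivity
          have : C ≠ 0 := by positivity
          field_simp
    calc γ * c / 4 * d ^ (j + 1) = γ * d / 2 * (c * d ^ j / 2) := by ring
      _ ≤ ⌊γ * d⌋₊ * (c * d ^ j - ⌊γ * d⌋₊ * (C * d ^ j / d)) := by
        refine mul_le_mul hx2 (by linarith) (by positivity) (by positivity)

set_option maxHeartbeats 1000000 in
/-- In a regular graph the revolutionaries can evade the spies, and if a large group and the
revolutionaries on `B` cannot meet, then many pairs are not edges. -/
theorem exists_regular_bounds (hK : 0 ≤ K) {i : ℕ} (hi : 1 ≤ i) :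
    ∃ c κ : ℝ, 0 < c ∧ 0 < κ ∧ ∀ (n : ℕ) (G : SimpleGraph (Fin n)) (d : ℝ) (k q : ℕ),
      Regular G K d (i + 1) → 1 ≤ q → q ≤ k → (k : ℝ) ≤ κ * d → k * d ^ (i + 1) ≤ κ * n →
      (∀ (x : Fin n) (S : Finset (Fin n)), x ∉ S → S.card ≤ k →
        max 2 q ≤ (cball G 1 {x} \ cball G 1 S).card) ∧
      ∀ (a : Fin n) (S B : Finset (Fin n)), a ∉ S → a ∉ B → Disjoint S B → S.card ≤ k →
        B.card = q → ¬ CanMeet G (i + 1) a S B →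
        c * q * d ^ (2 * i + 1) ≤
          ((meetLeft G i a S B).card * (meetRight G i a S B).card : ℕ) := by
  set C : ℝ := 2 * ((2 * K + 2) * 10 ^ (i + 1)) with hCdef
  have hC : 1 ≤ C := by
    have : (1 : ℝ) ≤ 10 ^ (i + 1) := one_le_pow₀ (by norm_num)
    nlinarith
  obtain ⟨c₁, D₁, hc₁, -, hb₁⟩ := exists_le_card_cball hC i
  obtain ⟨c₂, D₂, hc₂, -, hb₂⟩ := exists_le_card_cball hC (i + 1)
  -- With `κ = 1 / M`, each summand makes one of the error terms below small enough.
  set M : ℝ := 16 + |D₁| + |D₂| + 16 * C + (6 * C + 2 * 5 ^ i) / c₁ + (4 * C + 4 * 5 ^ i) / c₂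
    with hM
  have e1 : 0 ≤ (6 * C + 2 * 5 ^ i) / c₁ := by positivity
  have e2 : 0 ≤ (4 * C + 4 * 5 ^ i) / c₂ := by positivity
  have e3 := abs_nonneg D₁
  have e4 := abs_nonneg D₂
  have hM0 : 16 ≤ M := by linarith
  refine ⟨c₁ / 2 * (c₂ / 2), 1 / M, by positivity, by positivity, ?_⟩
  intro n G d k q hG hq hqk hkd hkn
  have hk1 : (1 : ℝ) ≤ k := by exact_mod_cast hq.trans hqk
  have hq1 : (1 : ℝ) ≤ q := by exact_mod_cast hq
  have hqk' : (q : ℝ) ≤ k := by exact_mod_cast hqk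
  have hkM : M * k ≤ d := by
    rw [div_mul_eq_mul_div, one_mul, le_div_iff₀ (by positivity)] at hkd
    linarith
  have hMd : M ≤ d := by nlinarith
  have hd : 1 ≤ d := by linarith
  have hd0 : 0 < d := by linarith
  have hknM : M * (k * d ^ (i + 1)) ≤ n := by
    rw [div_mul_eq_mul_div, one_mul, le_div_iff₀ (by positivity)] at hkn
    linarith
  have hkn1 : k * d ^ (i + 1) ≤ n := by
    have : 0 ≤ k * d ^ (i + 1) := by positivity
    nlinarith
  have hdn : d ^ (i + 1) ≤ n := by
    refine le_trans ?_ hkn1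
    exact le_mul_of_one_le_left (by positivity) hk1
  have hn0 : (0 : ℝ) < n := lt_of_lt_of_le (by positivity) hdn
  have hI := hG.card_inter_le hK hd
  -- Up to radius `i` the term with `1 / n` is dominated, because `d ^ (i + 1) ≤ n`.
  have hI' : ∀ j ≤ i, ∀ u v, u ≠ v →
      ((cball G j {u} ∩ cball G j {v}).card : ℝ) * d ≤ C * d ^ j := by
    intro j hj u v huv
    cases j with
    | zero =>
      have : cball G 0 {u} ∩ cball G 0 {v} = ∅ :=
        Finset.singleton_inter_of_notMem (by simpa using huv)
      rw [this]
      simp only [Finset.card_empty, Nat.cast_zero, zero_mul]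
      positivity
    | succ j =>
      have h1 := hI j (by omega) u v huv
      have h2 : d ^ (2 * (j + 1)) / n ≤ d ^ j := by
        rw [div_le_iff₀ hn0]
        calc d ^ (2 * (j + 1)) = d ^ j * d ^ (j + 2) := by ring
          _ ≤ d ^ j * n := by
            refine mul_le_mul_of_nonneg_left (le_trans ?_ hdn) (by positivity)
            exact pow_le_pow_right₀ hd (by omega)
      have h3 : (10 : ℝ) ^ (j + 1) ≤ 10 ^ (i + 1) := pow_le_pow_right₀ (by norm_num) (by omega)
      calc ((cball G (j + 1) {u} ∩ cball G (j + 1) {v}).card : ℝ) * d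
          ≤ ((2 * K + 2) * 10 ^ (j + 1) * (d ^ j + d ^ (2 * (j + 1)) / n)) * d := by gcongr
        _ ≤ ((2 * K + 2) * 10 ^ (i + 1) * (d ^ j + d ^ j)) * d := by gcongr
        _ = C * d ^ (j + 1) := by rw [hCdef]; ring
  have hI'' : ∀ j ≤ i, ∀ u v, u ≠ v →
      ((cball G j {u} ∩ cball G j {v}).card : ℝ) ≤ C * d ^ j / d := by
    intro j hj u v huv
    rw [le_div_iff₀ hd0]
    exact hI' j hj u v huv
  have hl₁ : ∀ v, c₁ * d ^ i ≤ (cball G i {v}).card :=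
    hb₁ n G d (by linarith [le_abs_self D₁]) hd hG.le_dg fun j hj => hI' j hj.le
  have hl₂ : ∀ v, c₂ * d ^ (i + 1) ≤ (cball G (i + 1) {v}).card :=
    hb₂ n G d (by linarith [le_abs_self D₂]) hd hG.le_dg fun j hj => hI' j (by omega)
  have hkd' : ∀ X : ℝ, 0 ≤ X → X ≤ M → X * k ≤ d := fun X _ h =>
    (mul_le_mul_of_nonneg_right h (by linarith)).trans hkM
  refine ⟨?_, ?_⟩
  · intro x S hxS hS
    have hS' : (S.card : ℝ) ≤ k := by exact_mod_cast hS
    -- Each spy blocks at most `C` of the `d / 4` or more places, and `k * C ≤ d / 16`.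
    have h1 : ((cball G 1 {x} ∩ cball G 1 S).card : ℝ) ≤ S.card * C := by
      refine card_inter_cball_le fun v hv => ?_
      have := hI'' 1 hi x v (by rintro rfl; exact hxS hv)
      rwa [pow_one, mul_div_assoc, div_self hd0.ne', mul_one] at this
    have h2 := le_card_sdiff_cast (cball G 1 {x}) (cball G 1 S)
    have h3 : d / 4 ≤ (cball G 1 {x}).card := by
      rw [card_cball_one]
      push_cast
      linarith [hG.le_dg x]
    have h4 : 16 * C * k ≤ d := hkd' _ (by positivity) (by linarith)
    have h5 : 16 * k ≤ d := hkd' 16 (by norm_num) hM0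
    have h6 : (S.card : ℝ) * C ≤ k * C := by gcongr
    refine max_le ?_ ?_
    · have : (2 : ℝ) ≤ (cball G 1 {x} \ cball G 1 S).card := by linarith
      exact_mod_cast this
    · have : (q : ℝ) ≤ (cball G 1 {x} \ cball G 1 S).card := by linarith
      exact_mod_cast this
  · intro a S B haS haB hSB hS hB hmeet
    have hS' : (S.card : ℝ) ≤ k := by exact_mod_cast hS
    have hpB : ((pball G i B).card : ℝ) ≤ q * (5 ^ i * (d ^ i / d)) := by
      obtain ⟨l, rfl⟩ : ∃ l, i = l + 1 := ⟨i - 1, by omega⟩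
      have h1 := hG.card_cball_le hd l B
      rw [hB] at h1
      refine h1.trans ?_
      have h2 : d ^ (l + 1) / d = d ^ l := by rw [pow_succ, mul_div_assoc, div_self hd0.ne', mul_one]
      rw [h2]
      have : (5 : ℝ) ^ l ≤ 5 ^ (l + 1) := pow_le_pow_right₀ (by norm_num) (by omega)
      gcongr
    have hdi : d ^ i / d * k ≤ d ^ i / M := by
      rw [div_mul_eq_mul_div, div_le_div_iff₀ hd0 (by linarith)]
      calc d ^ i * k * M = d ^ i * (M * k) := by ring
        _ ≤ d ^ i * d := by gcongr
    have hdi0 : 0 ≤ d ^ i / d := by positivity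
    -- the left side
    have hleft : c₂ / 2 * d ^ (i + 1) ≤ (meetLeft G i a S B).card := by
      have h1 : cball G (i + 1) {a} ∩ (cball G (i + 1) S ∪ meetReveal G i a S B) ⊆
          (cball G (i + 1) {a} ∩ cball G (i + 1) S) ∪ cball G i {a} ∪ pball G i B := by
        intro w hw
        simp only [meetReveal, Finset.mem_inter, Finset.mem_union] at hw ⊢
        rcases hw with ⟨h1, h2 | (h2 | h2) | h2⟩
        · exact Or.inl (Or.inl ⟨h1, h2⟩)
        · exact Or.inl (Or.inr h2)
        · exact Or.inl (Or.inl ⟨h1, cball_subset_succ h2⟩)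
        · exact Or.inr h2
      have h2 : ((cball G (i + 1) {a} ∩ (cball G (i + 1) S ∪ meetReveal G i a S B)).card : ℝ) ≤
          (cball G (i + 1) {a} ∩ cball G (i + 1) S).card + (cball G i {a}).card +
            (pball G i B).card := by
        exact_mod_cast (Finset.card_le_card h1).trans ((Finset.card_union_le _ _).trans
          (Nat.add_le_add_right (Finset.card_union_le _ _) _))
      have h3 : ((cball G (i + 1) {a} ∩ cball G (i + 1) S).card : ℝ) ≤
          S.card * (C / 2 * (d ^ i + d ^ (2 * (i + 1)) / n)) := by
        refine card_inter_cball_le fun v hv => ?_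
        have := hI i (by omega) a v (by rintro rfl; exact haS hv)
        refine this.trans (le_of_eq ?_)
        rw [hCdef]; ring
      have h4 := hG.card_cball_le hd i {a}
      rw [Finset.card_singleton, Nat.cast_one, one_mul] at h4
      have h5 := le_card_sdiff_cast (cball G (i + 1) {a})
        (cball G (i + 1) S ∪ meetReveal G i a S B)
      have h6 := hl₂ a
      have h7 : (k : ℝ) * d ^ i ≤ d ^ (i + 1) / M := by
        rw [le_div_iff₀ (by linarith)]
        calc k * d ^ i * M = d ^ i * (M * k) := by ring
          _ ≤ d ^ i * d := by gcongr
          _ = _ := (pow_succ d i).symm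
      -- At radius `i + 1` the term with `1 / n` may dominate; the bound on `k * d ^ (i + 1)`
      -- controls it.
      have h8 : (k : ℝ) * (d ^ (2 * (i + 1)) / n) ≤ d ^ (i + 1) / M := by
        rw [le_div_iff₀ (by linarith), ← mul_div_assoc, div_mul_eq_mul_div, div_le_iff₀ hn0]
        calc k * d ^ (2 * (i + 1)) * M = d ^ (i + 1) * (M * (k * d ^ (i + 1))) := by ring
          _ ≤ d ^ (i + 1) * n := by gcongr
      have h9 : (S.card : ℝ) * (C / 2 * (d ^ i + d ^ (2 * (i + 1)) / n)) ≤
          C * (d ^ (i + 1) / M) := by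
        calc _ ≤ k * (C / 2 * (d ^ i + d ^ (2 * (i + 1)) / n)) := by gcongr
          _ = C / 2 * (k * d ^ i + k * (d ^ (2 * (i + 1)) / n)) := by ring
          _ ≤ C / 2 * (d ^ (i + 1) / M + d ^ (i + 1) / M) := by gcongr
          _ = _ := by ring
      have h10 : (5 : ℝ) ^ i * d ^ i ≤ 5 ^ i * (d ^ (i + 1) / M) := by
        gcongr
        exact le_trans (le_mul_of_one_le_left (by positivity) hk1) h7
      have h11 : (q : ℝ) * (5 ^ i * (d ^ i / d)) ≤ 5 ^ i * (d ^ (i + 1) / M) := by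
        calc (q : ℝ) * (5 ^ i * (d ^ i / d)) ≤ k * (5 ^ i * d ^ i) := by
              gcongr
              exact div_le_self (by positivity) hd
          _ = 5 ^ i * (k * d ^ i) := by ring
          _ ≤ _ := by gcongr
      have h12 : (4 * C + 4 * 5 ^ i) * (d ^ (i + 1) / M) ≤ c₂ * d ^ (i + 1) := by
        rw [← mul_div_assoc, div_le_iff₀ (by linarith)]
        have : 4 * C + 4 * 5 ^ i ≤ c₂ * M := by
          rw [← div_le_iff₀' hc₂]; linarith
        calc (4 * C + 4 * 5 ^ i) * d ^ (i + 1) ≤ c₂ * M * d ^ (i + 1) := by gcongr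
          _ = _ := by ring
      have h13 : 0 ≤ C * (d ^ (i + 1) / M) := by positivity
      rw [meetLeft]
      linarith
    have hright : c₁ / 2 * (q * d ^ i) ≤ (meetRight G i a S B).card := by
      -- The `q` balls around `B` lose little to each other, to `a`, to `S` and to the smaller
      -- balls.
      have h1 : cball G i B ∩ (meetReveal G i a S B ∪ meetLeft G i a S B) ⊆
          (cball G i {a} ∩ cball G i B) ∪ (cball G i B ∩ cball G i S) ∪ pball G i B := by
        intro w hw
        have hw' : w ∈ cball G i B → w ∉ meetLeft G i a S B :=
          fun h => Finset.disjoint_left.1 (disjoint_of_not_canMeet hmeet) h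
        simp only [meetReveal, Finset.mem_inter, Finset.mem_union] at hw ⊢
        rcases hw with ⟨h1, ((h2 | h2) | h2) | h2⟩
        · exact Or.inl (Or.inl ⟨h2, h1⟩)
        · exact Or.inl (Or.inr ⟨h1, h2⟩)
        · exact Or.inr h2
        · exact absurd h2 (hw' h1)
      have h2 : ((cball G i B ∩ (meetReveal G i a S B ∪ meetLeft G i a S B)).card : ℝ) ≤
          (cball G i {a} ∩ cball G i B).card + (cball G i B ∩ cball G i S).card +
            (pball G i B).card := by
        exact_mod_cast (Finset.card_le_card h1).trans ((Finset.card_union_le _ _).trans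
          (Nat.add_le_add_right (Finset.card_union_le _ _) _))
      have h3 : ((cball G i {a} ∩ cball G i B).card : ℝ) ≤ q * (C * d ^ i / d) := by
        rw [← hB]
        exact card_inter_cball_le fun b hb => hI'' i le_rfl a b (by rintro rfl; exact haB hb)
      have h4 : ((cball G i B ∩ cball G i S).card : ℝ) ≤ S.card * (q * (C * d ^ i / d)) := by
        refine card_inter_cball_le fun v hv => ?_
        rw [Finset.inter_comm, ← hB]
        exact card_inter_cball_le fun b hb => hI'' i le_rfl v b (by
          rintro rfl; exact Finset.disjoint_left.1 hSB hv hb)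
      have h5 : (q : ℝ) * (c₁ * d ^ i - q * (C * d ^ i / d)) ≤ (cball G i B).card := by
        rw [cball_eq_biUnion (X := B)]
        have := le_card_biUnion B (fun x => cball G i {x}) (M := C * d ^ i / d) (by positivity)
          (fun b _ => hl₁ b) fun b _ b' _ h => hI'' i le_rfl b b' h
        rwa [hB] at this
      have h6 := le_card_sdiff_cast (cball G i B) (meetReveal G i a S B ∪ meetLeft G i a S B)
      rw [meetRight]
      set P := d ^ i / d with hP
      have hCP : C * d ^ i / d = C * P := by rw [hP, mul_div_assoc]
      rw [hCP] at h3 h4 h5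
      have h7 : (3 * C + 5 ^ i) * (k * P) ≤ c₁ / 2 * d ^ i := by
        have : (6 * C + 2 * 5 ^ i) * (d ^ i / M) ≤ c₁ * d ^ i := by
          rw [← mul_div_assoc, div_le_iff₀ (by linarith)]
          have : 6 * C + 2 * 5 ^ i ≤ c₁ * M := by
            rw [← div_le_iff₀' hc₁]; linarith
          calc (6 * C + 2 * 5 ^ i) * d ^ i ≤ c₁ * M * d ^ i := by gcongr
            _ = _ := by ring
        have h : (3 * C + 5 ^ i) * (k * P) ≤ (3 * C + 5 ^ i) * (d ^ i / M) := by
          rw [mul_comm (k : ℝ) P]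
          gcongr
        linarith
      have h8 : (S.card : ℝ) * (q * (C * P)) ≤ q * (C * (k * P)) := by
        calc (S.card : ℝ) * (q * (C * P)) ≤ k * (q * (C * P)) := by gcongr
          _ = _ := by ring
      have h9 : (q : ℝ) * (q * (C * P)) ≤ q * (C * (k * P)) := by
        calc (q : ℝ) * (q * (C * P)) ≤ q * (k * (C * P)) := by gcongr
          _ = _ := by ring
      have h10 : (q : ℝ) * (C * P) ≤ q * (C * (k * P)) := by
        have : P ≤ k * P := le_mul_of_one_le_left hdi0 hk1
        gcongr
      have h11 : (q : ℝ) * (5 ^ i * P) ≤ q * (5 ^ i * (k * P)) := by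
        have : P ≤ k * P := le_mul_of_one_le_left hdi0 hk1
        gcongr
      have h12 := mul_le_mul_of_nonneg_left h7 (by linarith : (0 : ℝ) ≤ q)
      have h13 : (q : ℝ) * ((3 * C + 5 ^ i) * (k * P)) =
          3 * (q * (C * (k * P))) + q * (5 ^ i * (k * P)) := by ring
      have h14 : (q : ℝ) * (c₁ * d ^ i - q * (C * P)) =
          c₁ * (q * d ^ i) - q * (q * (C * P)) := by ring
      have h15 : (q : ℝ) * (c₁ / 2 * d ^ i) = c₁ / 2 * (q * d ^ i) := by ring
      linarith
    push_cast
    calc c₁ / 2 * (c₂ / 2) * q * d ^ (2 * i + 1)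
        = (c₂ / 2 * d ^ (i + 1)) * (c₁ / 2 * (q * d ^ i)) := by ring
      _ ≤ _ := mul_le_mul hleft hright (by positivity) (by positivity)

end Geometry

end RevSpies

namespace RevSpies

/-! ### Asymptotically almost sure regularity. -/

open MeasureTheory SimpleGraph

lemma aas_iff {p : ℕ → unitInterval} {A : (n : ℕ) → SimpleGraph (Fin n) → Prop} :
    AAS p A ↔ Tendsto (fun n => (binomialRandom (Fin n) (p n)).real {G | ¬ A n G}) atTop (𝓝 0) := by
  have hms : ∀ n (S : Set (SimpleGraph (Fin n))), MeasurableSet S := fun n S => by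
    have := measurableSingletonClass_simpleGraph (Fin n)
    exact S.toFinite.measurableSet
  have h1 : ∀ n, (binomialRandom (Fin n) (p n)).real {G | ¬ A n G} =
      1 - (binomialRandom (Fin n) (p n)).real {G | A n G} := fun n => by
    rw [← probReal_compl_eq_one_sub (hms n _)]
    rfl
  simp only [h1]
  unfold AAS
  rw [← ENNReal.tendsto_toReal_iff (fun _ => measure_ne_top _ _) ENNReal.one_ne_top]
  constructor
  · intro h
    have := h.const_sub 1
    simpa [measureReal_def] using this
  · intro h
    have := h.const_sub 1
    simpa [measureReal_def] using this

lemma aas_mono {p : ℕ → unitInterval} {A B : (n : ℕ) → SimpleGraph (Fin n) → Prop} (hA : AAS p A)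
    (h : ∀ᶠ n in atTop, ∀ G, A n G → B n G) : AAS p B := by
  rw [aas_iff] at hA ⊢
  refine squeeze_zero' (Eventually.of_forall fun _ => measureReal_nonneg) ?_ hA
  filter_upwards [h] with n hn
  exact measureReal_mono fun G hG hAG => hG (hn G hAG)

/-- Allows the failure of `B` to be estimated only where `A` holds. -/
lemma aas_and_of_le {p : ℕ → unitInterval} {A B : (n : ℕ) → SimpleGraph (Fin n) → Prop}
    (hA : AAS p A) {C : ℝ}
    (h : ∀ᶠ n : ℕ in atTop, (binomialRandom (Fin n) (p n)).real {G | A n G ∧ ¬ B n G} ≤ C / n) :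
    AAS p fun n G => A n G ∧ B n G := by
  rw [aas_iff] at hA ⊢
  have h0 := hA.add (tendsto_const_div_atTop_nhds_zero_nat C)
  rw [add_zero] at h0
  refine squeeze_zero' (Eventually.of_forall fun _ => measureReal_nonneg) ?_ h0
  filter_upwards [h] with n hn
  have hsub : {G : SimpleGraph (Fin n) | ¬ (A n G ∧ B n G)} ⊆
      {G | ¬ A n G} ∪ {G | A n G ∧ ¬ B n G} := by
    intro G hG
    by_cases hAG : A n G
    · exact Or.inr ⟨hAG, fun hB => hG ⟨hAG, hB⟩⟩
    · exact Or.inl hAG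
  exact (measureReal_mono hsub).trans ((measureReal_union_le _ _).trans (by gcongr))

lemma real_le_of_forall_exists {Ω ι : Type*} [MeasurableSpace Ω] (μ : Measure Ω)
    [IsFiniteMeasure μ] (s : Finset ι) (𝒮 : Set Ω) (𝒯 : ι → Set Ω) {b : ℝ}
    (h : ∀ x ∈ 𝒮, ∃ i ∈ s, x ∈ 𝒯 i) (hb : ∀ i ∈ s, μ.real (𝒯 i) ≤ b) :
    μ.real 𝒮 ≤ s.card * b := by
  have hsub : 𝒮 ⊆ ⋃ i ∈ s, 𝒯 i := fun x hx => by simpa using h x hx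
  refine (measureReal_mono hsub (measure_ne_top _ _)).trans ((measureReal_biUnion_finset_le s _).trans ?_)
  rw [← nsmul_eq_mul]
  exact Finset.sum_le_card_nsmul _ _ _ hb

section Fixed

variable {n : ℕ} (p : unitInterval)

lemma real_dg_lt_le (hn : 1 ≤ n) (v : Fin n) :
    (binomialRandom (Fin n) p).real {G | (dg G v : ℝ) < p * n / 4} ≤
      Real.exp (1 / 2 - p * n / 4) := by
  -- The `1 / 2` in the exponent of `c` pays for `n - 1` in place of `n`.
  have h := real_dg_le p (x := 1 / 2) (c := Real.exp (p * n / 4 - 1 / 2)) (by norm_num)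
    (Real.exp_pos _) (by linarith [p.2.2]) v (fun k => (k : ℝ) < p * n / 4) (by
      intro k hk
      have h1 : Real.exp (-1) ≤ 1 / 2 := by
        rw [Real.exp_neg, one_div]
        exact inv_anti₀ (by norm_num) (by linarith [Real.add_one_le_exp 1])
      have h2 : Real.exp (-k) ≤ (1 / 2) ^ k := by
        have : Real.exp (-k) = Real.exp (-1) ^ k := by
          rw [← Real.exp_nat_mul]; congr 1; ring
        rw [this]
        exact pow_le_pow_left₀ (Real.exp_pos _).le h1 k
      refine le_trans ?_ h2
      rw [← Real.exp_add, Real.exp_le_exp, Fintype.card_fin, Nat.cast_sub hn]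
      push_cast
      have := p.2.2
      nlinarith)
  refine h.trans (le_of_eq ?_)
  rw [one_div, ← Real.exp_neg]
  congr 1
  ring

lemma real_lt_dg_le (hn : 1 ≤ n) (v : Fin n) :
    (binomialRandom (Fin n) p).real {G | 4 * ((p : ℝ) * n) < (dg G v : ℝ)} ≤ Real.exp (-((p : ℝ) * n)) := by
  have h := real_dg_le p (x := 2) (c := Real.exp (p * n)) (by norm_num)
    (Real.exp_pos _) (by linarith [p.2.1]) v (fun k => 4 * ((p : ℝ) * n) < (k : ℝ)) (by
      intro k hk
      have h1 : Real.exp (1 / 2) ≤ 2 := by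
        have h3 : Real.exp (1 / 2) ^ 2 = Real.exp 1 := by
          rw [← Real.exp_nat_mul]; norm_num
        have h4 := Real.exp_one_lt_three
        nlinarith [Real.exp_pos (1 / 2)]
      have h2 : Real.exp (k / 2) ≤ 2 ^ k := by
        have : Real.exp (k / 2) = Real.exp (1 / 2) ^ k := by
          rw [← Real.exp_nat_mul]; congr 1; ring
        rw [this]
        exact pow_le_pow_left₀ (Real.exp_pos _).le h1 k
      refine le_trans ?_ h2
      rw [← Real.exp_add, Real.exp_le_exp, Fintype.card_fin, Nat.cast_sub hn]
      push_cast
      have := p.2.1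
      nlinarith)
  refine h.trans (le_of_eq ?_)
  rw [one_div, ← Real.exp_neg]

lemma card_filter_card_le (n k : ℕ) :
    ((Finset.univ : Finset (Finset (Fin n))).filter fun S => S.card ≤ k).card ≤ (n + 1) ^ k := by
  have hsub : ((Finset.univ : Finset (Finset (Fin n))).filter fun S => S.card ≤ k) ⊆
      (Finset.range (k + 1)).biUnion fun i => Finset.powersetCard i Finset.univ := by
    intro S hS
    simp only [Finset.mem_filter, Finset.mem_univ, true_and] at hS
    simp only [Finset.mem_biUnion, Finset.mem_range, Finset.mem_powersetCard]
    exact ⟨S.card, by omega, Finset.subset_univ _, rfl⟩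
  refine (Finset.card_le_card hsub).trans (Finset.card_biUnion_le.trans ?_)
  rw [add_pow]
  refine Finset.sum_le_sum fun i hi => ?_
  rw [Finset.card_powersetCard, Finset.card_univ, Fintype.card_fin, one_pow, mul_one]
  refine (Nat.choose_le_pow n i).trans (Nat.le_mul_of_pos_right _ ?_)
  exact Nat.choose_pos (by simpa [Nat.lt_succ_iff] using hi)

end Fixed

section Asymptotic

variable {p : ℕ → unitInterval} {δ : ℝ}

/-- The degrees are a.a.s. of order `p * n`. -/
lemma aas_dg (hd : ∀ᶠ n : ℕ in atTop, 16 * Real.log n ≤ p n * n) :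
    AAS p fun n G => ∀ v, (p n * n : ℝ) / 4 ≤ dg G v ∧ (dg G v : ℝ) ≤ 4 * ((p n : ℝ) * n) := by
  have h : AAS p fun n G => True ∧
      ∀ v, (p n * n : ℝ) / 4 ≤ dg G v ∧ (dg G v : ℝ) ≤ 4 * ((p n : ℝ) * n) := by
    refine aas_and_of_le (C := 2 * Real.exp 1) ?_ ?_
    · rw [aas_iff]; simp
    · filter_upwards [hd, eventually_ge_atTop 1] with n hdn hn
      have hn0 : (0 : ℝ) < n := by exact_mod_cast hn
      have hlog : 0 ≤ Real.log n := Real.log_natCast_nonneg n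
      have hexp : Real.exp (-(2 * Real.log n)) = 1 / (n * n) := by
        rw [Real.exp_neg, two_mul, Real.exp_add, Real.exp_log hn0, one_div]
      have hE : Real.exp (1 - 2 * Real.log n) = Real.exp 1 / (n * n) := by
        rw [sub_eq_add_neg, Real.exp_add, hexp]; ring
      refine (real_le_of_forall_exists _ (Finset.univ : Finset (Fin n × Bool)) _
        (fun i => if i.2 then {G | (dg G i.1 : ℝ) < p n * n / 4}
          else {G | 4 * ((p n : ℝ) * n) < (dg G i.1 : ℝ)}) (b := Real.exp (1 - 2 * Real.log n))
        ?_ ?_).trans ?_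
      · rintro G ⟨-, hG⟩
        push Not at hG
        obtain ⟨v, hv⟩ := hG
        by_cases hlt : (dg G v : ℝ) < p n * n / 4
        · exact ⟨(v, true), Finset.mem_univ _, by simpa using hlt⟩
        · exact ⟨(v, false), Finset.mem_univ _, by simpa using hv (not_lt.1 hlt)⟩
      · rintro ⟨v, b⟩ -
        cases b
        · refine le_trans (by simpa using real_lt_dg_le (p n) hn v) (Real.exp_le_exp.2 ?_)
          linarith
        · refine le_trans (by simpa using real_dg_lt_le (p n) hn v) (Real.exp_le_exp.2 ?_)
          linarith
      · rw [hE]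
        simp only [Finset.card_univ, Fintype.card_prod, Fintype.card_fin, Fintype.card_bool,
          Nat.cast_mul, Nat.cast_ofNat]
        apply le_of_eq
        field_simp
  exact aas_mono h (Eventually.of_forall fun n G hG => hG.2)

lemma card_crossPairs_le_of_dg {n : ℕ} {G : SimpleGraph (Fin n)} {d : ℝ} (hd : 1 ≤ d)
    (h : ∀ v, (dg G v : ℝ) ≤ 4 * d) (i : ℕ) (u v : Fin n) :
    (crossPairs G i u v).card ≤ ⌊5 * d⌋₊ ^ (2 * i + 1) := by
  have hΔ : ∀ v, (cball G 1 {v}).card ≤ ⌊5 * d⌋₊ := fun v => Nat.le_floor (by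
    rw [card_cball_one]; push_cast; linarith [h v])
  have h1 := card_cball_le (j := i + 1) (X := {u}) hΔ
  have h2 := card_cball_le (j := i) (X := {v}) hΔ
  simp only [Finset.card_singleton, one_mul] at h1 h2
  refine card_crossPairs_le.trans ((Nat.mul_le_mul h1 h2).trans (le_of_eq ?_))
  rw [← pow_add]; congr 1; ring

/-- The random graph is a.a.s. regular. -/
lemma exists_aas_regular (hδ : 0 < δ) (hd1 : ∀ᶠ n : ℕ in atTop, 16 * Real.log n ≤ p n * n)
    (hd2 : ∀ᶠ n : ℕ in atTop, (p n * n : ℝ) ^ 2 ≤ (n : ℝ) ^ (1 - δ)) (t : ℕ) :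
    ∃ K : ℝ, 0 ≤ K ∧ AAS p fun n G => Regular G K (p n * n) t := by
  -- Chosen so that `n ^ (δ * K₀) ≥ n ^ 3`, enough for a union over pairs of vertices.
  set K₀ : ℕ := ⌈3 / δ⌉₊ with hK₀
  set K : ℝ := K₀ + 3 + 2 * 5 ^ (2 * t + 1) with hK
  refine ⟨K, by positivity, ?_⟩
  have h := aas_and_of_le (aas_dg hd1) (C := t * Real.exp 5)
    (B := fun n G => ∀ i < t, ∀ u v, u ≠ v → (crossEdges G i u v : ℝ) ≤
      K * ((p n * n : ℝ) ^ i + (p n * n : ℝ) ^ (2 * (i + 1)) / n)) ?_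
  · exact aas_mono h (Eventually.of_forall fun n G hG =>
      ⟨fun v => (hG.1 v).1, fun v => (hG.1 v).2, hG.2⟩)
  filter_upwards [hd1, hd2, eventually_ge_atTop 3] with n hd hd2 hn
  have hn0 : (0 : ℝ) < n := by positivity
  have hn1 : (1 : ℝ) ≤ n := by exact_mod_cast (by omega : 1 ≤ n)
  have hlog : 1 ≤ Real.log n := by
    rw [Real.le_log_iff_exp_le hn0]
    exact Real.exp_one_lt_three.le.trans (by exact_mod_cast hn)
  set d : ℝ := p n * n with hddef
  have hd0 : 1 ≤ d := by linarith
  have hp0 : (0 : ℝ) ≤ p n := (p n).2.1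
  -- the thresholds
  let N : ℕ → ℕ := fun i => ⌊5 * d⌋₊ ^ (2 * i + 1)
  have hN : ∀ i, (p n : ℝ) * N i ≤ 5 ^ (2 * i + 1) * (d ^ (2 * (i + 1)) / n) := by
    intro i
    have h1 : (N i : ℝ) ≤ (5 * d) ^ (2 * i + 1) := by
      simp only [N]
      push_cast
      gcongr
      exact Nat.floor_le (by positivity)
    have h2 : (p n : ℝ) = d / n := by rw [hddef]; field_simp
    calc (p n : ℝ) * N i ≤ p n * (5 * d) ^ (2 * i + 1) := by gcongr
      _ = _ := by rw [h2, mul_pow]; ring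
  -- For `i ≥ 1` the logarithm is absorbed by `d ^ i`. For `i = 0`, where common neighbours are
  -- counted, the bound must be constant; this works because `d ^ 2 / n ≤ n ^ (-δ)`.
  let T : ℕ → ℕ := fun i => if i = 0 then K₀ else ⌈3 * Real.log n + 2 * (p n * N i)⌉₊
  have hn3 : Real.exp (-(3 * Real.log n)) = 1 / (n * n * n) := by
    rw [Real.exp_neg, show 3 * Real.log n = Real.log n + Real.log n + Real.log n by ring,
      Real.exp_add, Real.exp_add, Real.exp_log hn0, one_div]
  have hprob : ∀ i (u v : Fin n), (binomialRandom (Fin n) (p n)).real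
      {G | (crossPairs G i u v).card ≤ N i ∧ T i ≤ crossEdges G i u v} ≤
        Real.exp 5 * (1 / (n * n * n)) := by
    intro i u v
    by_cases hi : i = 0
    · subst hi
      -- With parameter `n ^ δ` the moment stays below `exp 5`.
      have hx : (1 : ℝ) ≤ (n : ℝ) ^ δ := Real.one_le_rpow hn1 hδ.le
      refine (real_crossEdges_le (p n) hx 0 u v (N 0) (T 0)).trans ?_
      have h1 : (p n : ℝ) * ((n : ℝ) ^ δ - 1) * N 0 ≤ 5 := by
        have h2 := hN 0
        have h3 : d ^ 2 / n * (n : ℝ) ^ δ ≤ 1 := by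
          rw [div_mul_eq_mul_div, div_le_one hn0]
          calc d ^ 2 * (n : ℝ) ^ δ ≤ (n : ℝ) ^ (1 - δ) * (n : ℝ) ^ δ := by gcongr
            _ = n := by rw [← Real.rpow_add hn0, sub_add_cancel, Real.rpow_one]
        have h4 : 0 ≤ (p n : ℝ) * N 0 := by positivity
        calc (p n : ℝ) * ((n : ℝ) ^ δ - 1) * N 0 ≤ (p n * N 0) * (n : ℝ) ^ δ := by nlinarith
          _ ≤ (5 ^ (2 * 0 + 1) * (d ^ (2 * (0 + 1)) / n)) * (n : ℝ) ^ δ := by gcongr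
          _ = 5 * (d ^ 2 / n * (n : ℝ) ^ δ) := by norm_num; ring
          _ ≤ 5 := by linarith
      have h5 : (n : ℝ) * n * n ≤ ((n : ℝ) ^ δ) ^ T 0 := by
        have : (n : ℝ) * n * n = (n : ℝ) ^ (3 : ℝ) := by
          norm_cast; ring
        rw [this, ← Real.rpow_natCast, ← Real.rpow_mul hn0.le]
        refine Real.rpow_le_rpow_of_exponent_le hn1 ?_
        simp only [T, if_true]
        have := Nat.le_ceil (3 / δ)
        rw [div_le_iff₀ hδ] at this
        rw [mul_comm]
        exact this
      rw [mul_one_div]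
      gcongr
    · refine (real_crossEdges_le (p n) (x := Real.exp 1) (Real.one_le_exp zero_le_one)
        i u v (N i) (T i)).trans ?_
      have h1 : 3 * Real.log n + 2 * (p n * N i) ≤ T i := by
        simp only [T, hi, if_false]
        exact Nat.le_ceil _
      rw [← Real.exp_nat_mul, mul_one, ← Real.exp_sub, ← hn3, ← Real.exp_add, Real.exp_le_exp]
      have h2 := Real.exp_one_lt_three
      have h3 : 0 ≤ (p n : ℝ) * N i := by positivity
      nlinarith
  refine (real_le_of_forall_exists _
    ((Finset.range t) ×ˢ (Finset.univ : Finset (Fin n × Fin n))) _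
    (fun i => {G | (crossPairs G i.1 i.2.1 i.2.2).card ≤ N i.1 ∧
      T i.1 ≤ crossEdges G i.1 i.2.1 i.2.2}) ?_ (fun i _ => hprob i.1 i.2.1 i.2.2)).trans ?_
  · rintro G ⟨hG, hcross⟩
    push Not at hcross
    obtain ⟨i, hi, u, v, huv, hlt⟩ := hcross
    refine ⟨(i, u, v), Finset.mem_product.2 ⟨Finset.mem_range.2 hi, Finset.mem_univ _⟩,
      card_crossPairs_le_of_dg hd0 (fun v => (hG v).2) i u v, ?_⟩
    by_contra hT
    push Not at hT
    refine absurd hlt (not_lt.2 ?_)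
    have hQ : 0 ≤ d ^ (2 * (i + 1)) / (n : ℝ) := by positivity
    have hPi : 1 ≤ d ^ i := one_le_pow₀ hd0
    by_cases hi0 : i = 0
    · subst hi0
      simp only [T, if_true] at hT
      have h1 : (crossEdges G 0 u v : ℝ) ≤ K₀ := by exact_mod_cast hT.le
      have h2 : (K₀ : ℝ) ≤ K := by
        have : (0 : ℝ) ≤ 2 * 5 ^ (2 * t + 1) := by positivity
        linarith
      have h3 : 0 ≤ K := by positivity
      rw [pow_zero]
      nlinarith
    · simp only [T, hi0, if_false] at hT
      have h1 := Nat.lt_ceil.1 hT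
      have h2 := hN i
      have h3 : (5 : ℝ) ^ (2 * i + 1) ≤ 5 ^ (2 * t + 1) := pow_le_pow_right₀ (by norm_num) (by omega)
      have h4 : Real.log n ≤ d ^ i :=
        (by linarith : Real.log n ≤ d).trans (le_self_pow₀ hd0 hi0)
      have h5 : 3 * d ^ i ≤ K * d ^ i := by
        have : (0 : ℝ) ≤ 2 * 5 ^ (2 * t + 1) := by positivity
        have : (0 : ℝ) ≤ K₀ := by positivity
        refine mul_le_mul_of_nonneg_right ?_ (by linarith)
        linarith
      have h6 : 2 * (5 ^ (2 * i + 1) * (d ^ (2 * (i + 1)) / n)) ≤ K * (d ^ (2 * (i + 1)) / n) := by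
        rw [← mul_assoc]
        have : (0 : ℝ) ≤ K₀ := by positivity
        refine mul_le_mul_of_nonneg_right ?_ hQ
        linarith
      rw [mul_add]
      linarith
  · rw [Finset.card_product, Finset.card_range, Finset.card_univ, Fintype.card_prod,
      Fintype.card_fin]
    push_cast
    apply le_of_eq
    field_simp

end Asymptotic

end RevSpies

namespace RevSpies

/-! ### The union bound and the spy number. -/

open MeasureTheory SimpleGraph

lemma mul_floor_bounds {ε : ℝ} {k : ℕ} (hk : 2 ≤ ε * k) :
    ε / 2 * k ≤ (⌊ε * k⌋₊ : ℝ) ∧ (⌊ε * k⌋₊ : ℝ) ≤ ε * k := by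
  refine ⟨?_, Nat.floor_le (by linarith)⟩
  have := Nat.lt_floor_add_one (ε * k)
  linarith

/-- A.a.s. the revolutionaries can evade `k` spies, and a large group can be joined by one of any
`ε * k` revolutionaries. -/
lemma aas_evade_and_meet {p : ℕ → unitInterval} {δ : ℝ} (hδ : 0 < δ)
    (hd1 : ∀ᶠ n : ℕ in atTop, 16 * Real.log n ≤ p n * n)
    (hd2 : ∀ᶠ n : ℕ in atTop, (p n * n : ℝ) ^ 2 ≤ (n : ℝ) ^ (1 - δ)) {i : ℕ} (hi : 1 ≤ i)
    {k : ℕ → ℕ} (hk : Tendsto k atTop atTop)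
    (hkd : ∀ κ : ℝ, 0 < κ → ∀ᶠ n : ℕ in atTop, (k n : ℝ) ≤ κ * (p n * n))
    (hkn : ∀ κ : ℝ, 0 < κ → ∀ᶠ n : ℕ in atTop, (k n : ℝ) * (p n * n : ℝ) ^ (i + 1) ≤ κ * n)
    (hdn : ∀ A : ℝ, ∀ᶠ n : ℕ in atTop, A * (n * Real.log n) ≤ (p n * n : ℝ) ^ (2 * (i + 1)))
    {ε : ℝ} (hε : 0 < ε) (hε1 : ε ≤ 1) :
    AAS p fun n G =>
      (∀ (x : Fin n) (S : Finset (Fin n)), x ∉ S → S.card ≤ k n →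
        max 2 ⌊ε * k n⌋₊ ≤ (cball G 1 {x} \ cball G 1 S).card) ∧
      ∀ (a : Fin n) (S B : Finset (Fin n)), a ∉ S → a ∉ B → Disjoint S B → S.card ≤ k n →
        B.card = ⌊ε * k n⌋₊ → CanMeet G (i + 1) a S B := by
  obtain ⟨K, hK, hreg⟩ := exists_aas_regular hδ hd1 hd2 (i + 1)
  obtain ⟨c, κ, hc, hκ, hbounds⟩ := exists_regular_bounds hK hi
  have hkε : ∀ᶠ n in atTop, 2 ≤ ε * k n :=
    (tendsto_natCast_atTop_atTop.comp hk).const_mul_atTop hε |>.eventually_ge_atTop 2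
  have hq : ∀ᶠ n in atTop, 1 ≤ ⌊ε * k n⌋₊ ∧ ⌊ε * k n⌋₊ ≤ k n := by
    filter_upwards [hkε] with n hn
    refine ⟨Nat.le_floor (by push_cast; linarith), ?_⟩
    refine (Nat.floor_le_floor (mul_le_of_le_one_left (Nat.cast_nonneg _) hε1)).trans ?_
    rw [Nat.floor_natCast]
  have h := aas_and_of_le hreg (C := 1)
    (B := fun n G => ∀ (a : Fin n) (S B : Finset (Fin n)), a ∉ S → a ∉ B → Disjoint S B →
      S.card ≤ k n → B.card = ⌊ε * k n⌋₊ → CanMeet G (i + 1) a S B) ?_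
  · refine aas_mono h ?_
    filter_upwards [hq, hkd κ hκ, hkn κ hκ] with n hqn h1 h2 G hG
    exact ⟨(hbounds n G _ (k n) _ hG.1 hqn.1 hqn.2 h1 h2).1, hG.2⟩
  filter_upwards [hq, hkε, hkd κ hκ, hkn κ hκ, hdn (12 / (c * ε)), hd2, eventually_ge_atTop 2]
    with n hqn hkε h1 h2 hdA hd2 hn
  have hn0 : (0 : ℝ) < n := by positivity
  have hn2 : (2 : ℝ) ≤ n := by exact_mod_cast hn
  have hlog : 0 ≤ Real.log n := Real.log_natCast_nonneg n
  have hk1 : (1 : ℝ) ≤ k n := by exact_mod_cast hqn.1.trans hqn.2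
  have hp0 : (0 : ℝ) ≤ p n := (p n).2.1
  have hp1 : (p n : ℝ) < 1 := by
    refine lt_of_le_of_ne (p n).2.2 fun hp => ?_
    rw [hp, one_mul] at hd2
    have : (n : ℝ) ^ (1 - δ) ≤ n := by
      calc (n : ℝ) ^ (1 - δ) ≤ (n : ℝ) ^ (1 : ℝ) :=
            Real.rpow_le_rpow_of_exponent_le (by linarith) (by linarith)
        _ = n := Real.rpow_one _
    nlinarith
  set d : ℝ := p n * n with hd
  set q := ⌊ε * k n⌋₊ with hqdef
  set N := ⌈c * q * d ^ (2 * i + 1)⌉₊ with hN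
  set F := (Finset.univ : Finset (Finset (Fin n))).filter fun S => S.card ≤ k n with hF
  -- There are at most `exp ((4 * k + 1) * log n)` triples `(a, S, B)`, so the factor `6` leaves a
  -- failure probability of at most `1 / n`.
  have hpN : 6 * k n * Real.log n ≤ p n * N := by
    have e1 := Nat.le_ceil (c * q * d ^ (2 * i + 1))
    have e2 : (p n : ℝ) = d / n := by rw [hd]; field_simp
    have e3 := (mul_floor_bounds hkε).1
    calc 6 * k n * Real.log n = c * (ε / 2 * k n) * ((12 / (c * ε) * (n * Real.log n)) / n) := by
          field_simp; ring
      _ ≤ c * q * (d ^ (2 * (i + 1)) / n) := by gcongr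
      _ = p n * (c * q * d ^ (2 * i + 1)) := by rw [e2]; ring
      _ ≤ p n * N := by gcongr
  refine (real_le_of_forall_exists _
    ((Finset.univ : Finset (Fin n)) ×ˢ (F ×ˢ F)) _
    (fun x => {G | N ≤ (meetLeft G i x.1 x.2.1 x.2.2).card * (meetRight G i x.1 x.2.1 x.2.2).card ∧
      ¬ CanMeet G (i + 1) x.1 x.2.1 x.2.2}) ?_
    (fun x _ => real_not_canMeet_le (p n) hp1 i x.1 x.2.1 x.2.2 N)).trans ?_
  · rintro G ⟨hG, hmeet⟩
    push Not at hmeet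
    obtain ⟨a, S, B, haS, haB, hSB, hS, hB, hmeet⟩ := hmeet
    refine ⟨(a, S, B), ?_, ?_, hmeet⟩
    · simp only [hF, Finset.mem_product, Finset.mem_univ, Finset.mem_filter, true_and]
      exact ⟨hS, hB.le.trans hqn.2⟩
    · exact Nat.ceil_le.2
        ((hbounds n G d (k n) q hG hqn.1 hqn.2 h1 h2).2 a S B haS haB hSB hS hB hmeet)
  · have hFcard : (F.card : ℝ) ≤ Real.exp (2 * k n * Real.log n) := by
      have e1 : (F.card : ℝ) ≤ ((n : ℝ) + 1) ^ k n := by exact_mod_cast card_filter_card_le n (k n)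
      have e2 : (n : ℝ) + 1 ≤ Real.exp (2 * Real.log n) := by
        rw [two_mul, Real.exp_add, Real.exp_log hn0]; nlinarith
      refine e1.trans ((pow_le_pow_left₀ (by positivity) e2 _).trans (le_of_eq ?_))
      rw [← Real.exp_nat_mul]; congr 1; ring
    rw [Finset.card_product, Finset.card_product, Finset.card_univ, Fintype.card_fin]
    push_cast
    calc (n : ℝ) * (F.card * F.card) * Real.exp (-(p n * N))
        ≤ Real.exp (Real.log n) * (Real.exp (2 * k n * Real.log n) *
          Real.exp (2 * k n * Real.log n)) * Real.exp (-(6 * k n * Real.log n)) := by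
          rw [Real.exp_log hn0]
          gcongr
      _ = Real.exp (-((2 * k n - 1) * Real.log n)) := by
          rw [← Real.exp_add, ← Real.exp_add, ← Real.exp_add]; congr 1; ring
      _ ≤ Real.exp (-Real.log n) := by
          rw [Real.exp_le_exp]; nlinarith
      _ = 1 / n := by rw [Real.exp_neg, Real.exp_log hn0, one_div]

/-- The spy number is a.a.s. asymptotic to `r - m`, if the revolutionaries can meet in `i + 1`
rounds. -/
theorem aas_spyNumber {p : ℕ → unitInterval} {δ : ℝ} (hδ : 0 < δ)
    (hd1 : ∀ᶠ n : ℕ in atTop, 16 * Real.log n ≤ p n * n)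
    (hd2 : ∀ᶠ n : ℕ in atTop, (p n * n : ℝ) ^ 2 ≤ (n : ℝ) ^ (1 - δ)) {i : ℕ} (hi : 1 ≤ i)
    {r m : ℕ → ℕ} (hm : ∀ n, 1 ≤ m n)
    (hrm : Tendsto (fun n => (r n : ℝ) - (m n : ℝ)) atTop atTop)
    (hkd : ∀ κ : ℝ, 0 < κ → ∀ᶠ n : ℕ in atTop, (r n : ℝ) - m n ≤ κ * (p n * n))
    (hkn : ∀ κ : ℝ, 0 < κ → ∀ᶠ n : ℕ in atTop,
      ((r n : ℝ) - m n) * (p n * n : ℝ) ^ (i + 1) ≤ κ * n)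
    (hdn : ∀ A : ℝ, ∀ᶠ n : ℕ in atTop, A * (n * Real.log n) ≤ (p n * n : ℝ) ^ (2 * (i + 1)))
    {ε : ℝ} (hε : 0 < ε) :
    AAS p fun n G => |(spyNumber G (r n) (m n) : ℝ) - ((r n : ℝ) - (m n : ℝ))| ≤
      ε * ((r n : ℝ) - (m n : ℝ)) := by
  have hcast : ∀ᶠ n in atTop, r n = m n + (r n - m n) ∧
      ((r n - m n : ℕ) : ℝ) = (r n : ℝ) - m n := by
    filter_upwards [hrm.eventually_ge_atTop 0] with n hn
    have : m n ≤ r n := by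
      have : (m n : ℝ) ≤ r n := by linarith
      exact_mod_cast this
    exact ⟨by omega, by push_cast [this]; rfl⟩
  have hk : Tendsto (fun n => r n - m n) atTop atTop := by
    rw [← tendsto_natCast_atTop_iff (R := ℝ)]
    refine hrm.congr' ?_
    filter_upwards [hcast] with n hn using hn.2.symm
  -- Capping `ε` at `1` ensures `q ≤ k`.
  set ε' := min ε 1 with hε'
  have hε'0 : 0 < ε' := lt_min hε one_pos
  have hε'1 : ε' ≤ 1 := min_le_right _ _
  have h := aas_evade_and_meet hδ hd1 hd2 hi hk
    (fun κ hκ => by filter_upwards [hkd κ hκ, hcast] with n h1 h2; rw [h2.2]; exact h1)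
    (fun κ hκ => by filter_upwards [hkn κ hκ, hcast] with n h1 h2; rw [h2.2]; exact h1)
    hdn hε'0 hε'1
  refine aas_mono h ?_
  -- This gives `1 ≤ q` and absorbs the `+ 1` of the upper bound.
  have hkε : ∀ᶠ n in atTop, 2 ≤ ε' * ((r n : ℝ) - m n) :=
    hrm.const_mul_atTop hε'0 |>.eventually_ge_atTop 2
  filter_upwards [hcast, hkε, eventually_ge_atTop 1] with n hn hkε hn1 G ⟨hA, hB⟩
  have : Nonempty (Fin n) := ⟨⟨0, hn1⟩⟩
  set k := r n - m n with hkdef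
  rw [← hn.2] at hkε ⊢
  have hq := mul_floor_bounds hkε
  set q := ⌊ε' * k⌋₊ with hqdef
  have hk0 : (0 : ℝ) ≤ k := Nat.cast_nonneg _
  have hqk : q ≤ k := by
    have : (q : ℝ) ≤ k := hq.2.trans (mul_le_of_le_one_left hk0 hε'1)
    exact_mod_cast this
  have hq1 : 1 ≤ q := Nat.le_floor (by push_cast; linarith)
  have hbounds := spyNumber_bounds (G := G) (hm n) hn.1 (s₀ := k - q) fun s hs =>
    not_spiesWin (q := q) (t := i + 1) (hm n) hq1 (by omega)
      (fun x S hx hS => hA x S hx (hS.trans (by omega)))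
      (fun a S B h1 h2 h3 h4 h5 => hB a S B h1 h2 h3 (h4.trans (by omega)) h5)
  have hε'ε : ε' * k ≤ ε * k := by gcongr; exact min_le_left _ _
  have hlow : (k : ℝ) < spyNumber G (r n) (m n) + q := by
    have := hbounds.1
    exact_mod_cast (by omega : k < spyNumber G (r n) (m n) + q)
  have hup : (spyNumber G (r n) (m n) : ℝ) ≤ k + 1 := by exact_mod_cast hbounds.2
  rw [abs_le]
  constructor <;> linarith [hq.2]

end RevSpies

namespace RevSpies

/-! ### Growth rates and the choice of the radius. -/

section Growth

lemma eventually_log_le_rpow (A : ℝ) {δ : ℝ} (hδ : 0 < δ) :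
    ∀ᶠ n : ℕ in atTop, A * Real.log n ≤ (n : ℝ) ^ δ := by
  have h := ((isLittleO_log_rpow_atTop hδ).const_mul_left A).comp_tendsto
    (tendsto_natCast_atTop_atTop (R := ℝ))
  filter_upwards [h.bound one_pos] with n hn
  simp only [Function.comp, one_mul, Real.norm_eq_abs] at hn
  rw [abs_of_nonneg (Real.rpow_nonneg (Nat.cast_nonneg n) δ)] at hn
  exact (le_abs_self _).trans hn

variable {d e : ℕ → ℝ} {η : ℝ}

lemma eventually_rpow_le (he : Tendsto e atTop (𝓝 0))
    (hd : ∀ᶠ n : ℕ in atTop, d n = (n : ℝ) ^ (η + e n)) {a : ℝ} (ha : a < η) :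
    ∀ᶠ n : ℕ in atTop, (n : ℝ) ^ a ≤ d n := by
  filter_upwards [hd, he.eventually_const_lt (sub_neg.2 ha), eventually_ge_atTop 1] with n h1 h2 h3
  rw [h1]
  exact Real.rpow_le_rpow_of_exponent_le (by exact_mod_cast h3) (by linarith)

lemma eventually_le_rpow (he : Tendsto e atTop (𝓝 0))
    (hd : ∀ᶠ n : ℕ in atTop, d n = (n : ℝ) ^ (η + e n)) {b : ℝ} (hb : η < b) :
    ∀ᶠ n : ℕ in atTop, d n ≤ (n : ℝ) ^ b := by
  filter_upwards [hd, he.eventually_lt_const (sub_pos.2 hb), eventually_ge_atTop 1] with n h1 h2 h3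
  rw [h1]
  exact Real.rpow_le_rpow_of_exponent_le (by exact_mod_cast h3) (by linarith)

lemma le_pow_of_rpow_le {B x a : ℝ} (hB : 0 ≤ B) (k : ℕ) (ha : a * k = 1) (h : B ^ a ≤ x) :
    B ≤ x ^ k := by
  have h1 : (B ^ a) ^ k = B := by rw [← Real.rpow_natCast, ← Real.rpow_mul hB, ha, Real.rpow_one]
  rw [← h1]
  exact pow_le_pow_left₀ (Real.rpow_nonneg hB _) h k

lemma pow_le_of_le_rpow {B x a : ℝ} (hB : 0 ≤ B) (hx : 0 ≤ x) (k : ℕ) (ha : a * k = 1)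
    (h : x ≤ B ^ a) : x ^ k ≤ B := by
  have h1 : (B ^ a) ^ k = B := by rw [← Real.rpow_natCast, ← Real.rpow_mul hB, ha, Real.rpow_one]
  rw [← h1]
  exact pow_le_pow_left₀ hx h k

/-- In the sparse regime some radius `i + 1` satisfies both growth conditions. -/
lemma exists_radius (hη₀ : 0 < η) (hη₁ : η ≤ 1 / 6) (he : Tendsto e atTop (𝓝 0))
    (hd : ∀ᶠ n : ℕ in atTop, d n = (n : ℝ) ^ (η + e n)) :
    ∃ i : ℕ, 1 ≤ i ∧ (∀ᶠ n : ℕ in atTop, d n ^ (i + 2) ≤ n) ∧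
      ∀ A : ℝ, ∀ᶠ n : ℕ in atTop, A * (n * Real.log n) ≤ d n ^ (2 * (i + 1)) := by
  -- Then `i * η ≤ 1 / 2 < (i + 1) * η`. The right part makes the exponent of `d ^ (2 * (i + 1))`
  -- exceed `1`; the left one gives `(i + 2) * η ≤ 1 / 2 + 2 * η < 1`, as `η ≤ 1 / 6`.
  set i := ⌊1 / (2 * η)⌋₊ with hi
  have h1 : (i : ℝ) ≤ 1 / (2 * η) := Nat.floor_le (by positivity)
  have h2 : 1 / (2 * η) < i + 1 := Nat.lt_floor_add_one _
  have h3 : (i : ℝ) * η ≤ 1 / 2 := by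
    calc (i : ℝ) * η ≤ 1 / (2 * η) * η := by gcongr
      _ = 1 / 2 := by field_simp
  have h4 : 1 / 2 < (i + 1) * η := by
    calc (1 / 2 : ℝ) = 1 / (2 * η) * η := by field_simp
      _ < _ := by gcongr
  have hi1 : 1 ≤ i := Nat.le_floor (by
    rw [Nat.cast_one, le_div_iff₀ (by positivity)]; linarith)
  have hpos : ∀ᶠ n : ℕ in atTop, 0 ≤ d n := by
    filter_upwards [hd] with n hn
    rw [hn]; positivity
  refine ⟨i, hi1, ?_, fun A => ?_⟩
  · have hb : η < 1 / ((i : ℝ) + 2) := by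
      rw [lt_div_iff₀ (by positivity)]
      nlinarith
    filter_upwards [eventually_le_rpow he hd hb, hpos] with n hn h0
    exact pow_le_of_le_rpow (Nat.cast_nonneg n) h0 (i + 2) (by push_cast; field_simp) hn
  -- An exponent strictly in between leaves a power of `n` to beat `A * log n`.
  · set a := (η + 1 / (2 * ((i : ℝ) + 1))) / 2 with ha
    have hlt : 1 / (2 * ((i : ℝ) + 1)) < η := by
      rw [div_lt_iff₀ (by positivity)]
      linarith
    have ha1 : a < η := by rw [ha]; linarith
    have ha2 : 1 / (2 * ((i : ℝ) + 1)) < a := by rw [ha]; linarith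
    have hδ : 0 < a * (2 * (i + 1)) - 1 := by
      rw [div_lt_iff₀ (by positivity)] at ha2
      linarith
    filter_upwards [eventually_rpow_le he hd ha1, eventually_log_le_rpow A hδ,
      eventually_ge_atTop 1] with n hn hlog hn1
    have hn0 : (0 : ℝ) < n := by exact_mod_cast hn1
    calc A * (n * Real.log n) = n * (A * Real.log n) := by ring
      _ ≤ n * (n : ℝ) ^ (a * (2 * (i + 1)) - 1) := by gcongr
      _ = (n : ℝ) ^ (a * (2 * (i + 1))) := by
        rw [Real.rpow_sub_one hn0.ne']; field_simp
      _ = ((n : ℝ) ^ a) ^ (2 * (i + 1)) := by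
        rw [← Real.rpow_natCast, ← Real.rpow_mul hn0.le]; push_cast; rfl
      _ ≤ d n ^ (2 * (i + 1)) := by gcongr

end Growth

end RevSpies

/-! ### The three regimes. -/

theorem theorem1p6 (η : ℝ) (hη₀ : 0 < η) (hη₁ : η < 1 / 2)
    (p : ℕ → unitInterval)
    (hp : ∃ e : ℕ → ℝ, Tendsto e atTop (𝓝 0) ∧
      ∀ᶠ n : ℕ in atTop, (n : ℝ) * (p n : ℝ) = (n : ℝ) ^ (η + e n))
    (ω : ℕ → ℝ) (hω : Tendsto ω atTop atTop)
    (hω_slow : ∀ δ : ℝ, 0 < δ → ω =o[atTop] fun n : ℕ => (n : ℝ) ^ δ)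
    (r m : ℕ → ℕ) (hm : ∀ n, 1 ≤ m n)
    (hrm : Tendsto (fun n => (r n : ℝ) - (m n : ℝ)) atTop atTop)
    (hcases :
      (((fun n => (r n : ℝ) - (m n : ℝ)) =o[atTop]
            fun n : ℕ => min ((p n : ℝ) * n) ((n : ℝ) / ((p n : ℝ) * n) ^ 2)) ∧
          ∀ᶠ n : ℕ in atTop,
            (ω n * n * Real.log n) ^ (1 / 4 : ℝ) ≤ (p n : ℝ) * n) ∨
      (((fun n => (r n : ℝ) - (m n : ℝ)) =o[atTop]
            fun n : ℕ => (p n : ℝ) * n / (ω n * Real.log n)) ∧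
          ∀ᶠ n : ℕ in atTop,
            (ω n * n * Real.log n) ^ (1 / 6 : ℝ) ≤ (p n : ℝ) * n ∧
            (p n : ℝ) * n < (ω n * n * Real.log n) ^ (1 / 4 : ℝ)) ∨
      (((fun n => (r n : ℝ) - (m n : ℝ)) =o[atTop] fun n : ℕ => (p n : ℝ) * n) ∧
          ∀ᶠ n : ℕ in atTop,
            (p n : ℝ) * n < (ω n * n * Real.log n) ^ (1 / 6 : ℝ))) :
    ∀ ε : ℝ, 0 < ε →
      AAS p fun n G =>
        |(RevSpies.spyNumber G (r n) (m n) : ℝ) - ((r n : ℝ) - (m n : ℝ))| ≤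
          ε * ((r n : ℝ) - (m n : ℝ)) := by
  intro ε hε
  obtain ⟨e, he, hp⟩ := hp
  have hd : ∀ᶠ n : ℕ in atTop, (p n : ℝ) * n = (n : ℝ) ^ (η + e n) := by
    filter_upwards [hp] with n hn
    rw [mul_comm, hn]
  -- The second entry gives `2 * η < 1 - δ`, by `η < 1 / 2`.
  set δ := min (η / 2) ((1 - 2 * η) / 2) with hδdef
  have hδ : 0 < δ := lt_min (by linarith) (by linarith)
  have hd1 : ∀ᶠ n : ℕ in atTop, 16 * Real.log n ≤ p n * n := by
    filter_upwards [RevSpies.eventually_log_le_rpow 16 (half_pos hη₀),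
      RevSpies.eventually_rpow_le he hd (half_lt_self hη₀)] with n h1 h2
    exact h1.trans h2
  have hd2 : ∀ᶠ n : ℕ in atTop, (p n * n : ℝ) ^ 2 ≤ (n : ℝ) ^ (1 - δ) := by
    have hb : η < (1 - δ) / 2 := by
      have := min_le_right (η / 2) ((1 - 2 * η) / 2)
      linarith
    filter_upwards [RevSpies.eventually_le_rpow he hd hb] with n hn
    have h0 : (0 : ℝ) ≤ p n * n := mul_nonneg (p n).2.1 (Nat.cast_nonneg n)
    refine (pow_le_pow_left₀ h0 hn 2).trans (le_of_eq ?_)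
    rw [← Real.rpow_natCast, ← Real.rpow_mul (Nat.cast_nonneg n)]
    congr 1
    push_cast
    ring
  have hlog : ∀ᶠ n : ℕ in atTop, 1 ≤ Real.log n :=
    (Real.tendsto_log_atTop.comp tendsto_natCast_atTop_atTop).eventually_ge_atTop 1
  have hdpos : ∀ᶠ n : ℕ in atTop, 0 < (p n : ℝ) * n := by
    filter_upwards [hd1, hlog] with n h1 h2
    linarith
  have hB : ∀ᶠ n : ℕ in atTop, 0 ≤ ω n * n * Real.log n := by
    filter_upwards [hω.eventually_ge_atTop 0, hlog] with n h1 h2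
    positivity
  have hωA : ∀ A : ℝ, ∀ᶠ n : ℕ in atTop, A * (n * Real.log n) ≤ ω n * n * Real.log n := by
    intro A
    filter_upwards [hω.eventually_ge_atTop A, hlog] with n h1 h2
    rw [mul_assoc]
    gcongr
  rcases hcases with ⟨ho, hc⟩ | ⟨ho, hc⟩ | ⟨ho, hc⟩
  · have hk : ∀ κ : ℝ, 0 < κ → ∀ᶠ n : ℕ in atTop, (r n : ℝ) - m n ≤ κ * (p n * n) ∧
        ((r n : ℝ) - m n) * (p n * n : ℝ) ^ 2 ≤ κ * n := by
      intro κ hκ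
      filter_upwards [ho.bound hκ, hdpos] with n h1 h2
      have h3 : 0 ≤ min ((p n : ℝ) * n) ((n : ℝ) / ((p n : ℝ) * n) ^ 2) :=
        le_min h2.le (by positivity)
      rw [Real.norm_of_nonneg h3] at h1
      have h4 := (le_abs_self _).trans h1
      refine ⟨h4.trans (mul_le_mul_of_nonneg_left (min_le_left _ _) hκ.le), ?_⟩
      have h5 := h4.trans (mul_le_mul_of_nonneg_left (min_le_right _ _) hκ.le)
      rwa [← mul_div_assoc, le_div_iff₀ (by positivity)] at h5
    refine RevSpies.aas_spyNumber (i := 1) hδ hd1 hd2 le_rfl hm hrm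
      (fun κ hκ => (hk κ hκ).mono fun n h => h.1) (fun κ hκ => (hk κ hκ).mono fun n h => h.2)
      (fun A => ?_) hε
    filter_upwards [hc, hB, hωA A] with n h1 h2 h3
    exact h3.trans (RevSpies.le_pow_of_rpow_le h2 4 (by norm_num) h1)
  · have hk : ∀ κ : ℝ, 0 < κ → ∀ᶠ n : ℕ in atTop, (r n : ℝ) - m n ≤ κ * (p n * n) ∧
        ((r n : ℝ) - m n) * (p n * n : ℝ) ^ 3 ≤ κ * n := by
      intro κ hκ
      filter_upwards [ho.bound hκ, hdpos, hc, hB, hω.eventually_ge_atTop 1, hlog]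
        with n h1 h2 h3 h4 h5 h6
      have h7 : 1 ≤ ω n * Real.log n := by nlinarith
      have h8 : 0 ≤ (p n : ℝ) * n / (ω n * Real.log n) := by positivity
      rw [Real.norm_of_nonneg h8] at h1
      have h9 := (le_abs_self _).trans h1
      refine ⟨h9.trans (mul_le_mul_of_nonneg_left (div_le_self h2.le h7) hκ.le), ?_⟩
      -- The upper bound on `d` gives `d ^ 4 / (ω * log n) ≤ n`, which turns `k = o(d / (ω * log
      -- n))` into `k * d ^ 3 = o(n)`.
      have h10 := RevSpies.pow_le_of_le_rpow h4 h2.le 4 (by norm_num) h3.2.le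
      calc ((r n : ℝ) - m n) * (p n * n : ℝ) ^ 3
          ≤ κ * ((p n : ℝ) * n / (ω n * Real.log n)) * (p n * n : ℝ) ^ 3 := by gcongr
        _ = κ * ((p n * n : ℝ) ^ 4 / (ω n * Real.log n)) := by ring
        _ ≤ κ * n := by
          refine mul_le_mul_of_nonneg_left ?_ hκ.le
          rw [div_le_iff₀ (by linarith)]
          linarith
    refine RevSpies.aas_spyNumber (i := 2) hδ hd1 hd2 one_le_two hm hrm
      (fun κ hκ => (hk κ hκ).mono fun n h => h.1) (fun κ hκ => (hk κ hκ).mono fun n h => h.2)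
      (fun A => ?_) hε
    filter_upwards [hc, hB, hωA A] with n h1 h2 h3
    exact h3.trans (RevSpies.le_pow_of_rpow_le h2 6 (by norm_num) h1.1)
  -- If `η` exceeded `1 / 6`, `d` would beat `(ω * n * log n) ^ (1 / 6)`, since `ω * log n = n ^
  -- o(1)`.
  · have hη6 : η ≤ 1 / 6 := by
      by_contra hη
      push Not at hη
      set a := (η + 1 / 6) / 2 with ha
      have hδ' : 0 < (a * 6 - 1) / 2 := by linarith
      obtain ⟨n, h1, h2, h3, h4, h5, h6, h7⟩ := (hc.and (hB.and ((RevSpies.eventually_rpow_le he hd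
        (show a < η by linarith)).and ((RevSpies.eventually_log_le_rpow 1 hδ').and
        (((hω_slow _ hδ').bound one_pos).and (hlog.and (eventually_ge_atTop 1))))))).exists
      have hn0 : (0 : ℝ) < n := by exact_mod_cast h7
      have h8 : (n : ℝ) ^ a < (ω n * n * Real.log n) ^ (1 / 6 : ℝ) := h3.trans_lt h1
      have h9 : ω n ≤ (n : ℝ) ^ ((a * 6 - 1) / 2) := by
        rw [one_mul, Real.norm_of_nonneg (Real.rpow_nonneg hn0.le ((a * 6 - 1) / 2))] at h5
        exact (le_abs_self _).trans h5
      rw [one_mul] at h4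
      have h10 : ω n * n * Real.log n ≤ (n : ℝ) ^ (a * 6) := by
        calc ω n * n * Real.log n
            ≤ (n : ℝ) ^ ((a * 6 - 1) / 2) * n * (n : ℝ) ^ ((a * 6 - 1) / 2) := by gcongr
          _ = (n : ℝ) ^ ((a * 6 - 1) / 2 + 1 + (a * 6 - 1) / 2) := by
            rw [Real.rpow_add hn0, Real.rpow_add hn0, Real.rpow_one]
          _ = _ := by congr 1; ring
      refine absurd h8 (not_lt.2 ((Real.rpow_le_rpow h2 h10 (by norm_num)).trans (le_of_eq ?_)))
      rw [← Real.rpow_mul hn0.le]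
      congr 1
      ring
    obtain ⟨i, hi, hi1, hi2⟩ := RevSpies.exists_radius hη₀ hη6 he hd
    have hk : ∀ κ : ℝ, 0 < κ → ∀ᶠ n : ℕ in atTop, (r n : ℝ) - m n ≤ κ * (p n * n) := by
      intro κ hκ
      filter_upwards [ho.bound hκ, hdpos] with n h1 h2
      rw [Real.norm_of_nonneg h2.le] at h1
      exact (le_abs_self _).trans h1
    refine RevSpies.aas_spyNumber (i := i) hδ hd1 hd2 hi hm hrm hk (fun κ hκ => ?_) hi2 hε
    filter_upwards [hk κ hκ, hi1, hdpos] with n h1 h2 h3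
    calc ((r n : ℝ) - m n) * (p n * n : ℝ) ^ (i + 1)
        ≤ κ * (p n * n) * (p n * n : ℝ) ^ (i + 1) := by gcongr
      _ = κ * (p n * n : ℝ) ^ (i + 2) := by ring
      _ ≤ κ * n := by gcongr
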